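/- Let $a_1,a_2,b>0$ and $\mathcal I_{m_i},D_{l_i},D_{m_i},k_{s_i}>0$ ($i=1,2$), and put $D_l=\mathrm{diag}\{D_{l_1},D_{l_2}\}$, $D_m=\mathrm{diag}\{D_{m_1},D_{m_2}\}$, $K_s=\mathrm{diag}\{k_{s_1},k_{s_2}\}$, $R_2=\mathrm{blkdiag}\{D_l,D_m\}$, $M(q_{l_2})=\mathrm{blkdiag}\{M_l(q_{l_2}),\mathrm{diag}\{\mathcal I_{m_1},\mathcal I_{m_2}\}\}$ with $$M_l(q_{l_2})=\begin{bmatrix}a_1+a_2+2b\cos q_{l_2}&a_2+b\cos q_{l_2}\\a_2+b\cos q_{l_2}&a_2\end{bmatrix}.$$ Consider the planar robot with flexible joints, with state $q=(q_l,q_m)\in\mathbb R^4$, $p=(p_l,p_m)\in\mathbb R^4$ and input $u\in\mathbb R^2$, $$\dot q=\nabla_pH,\qquad \dot p=-\nabla_qH-R_2\nabla_pH+\begin{bmatrix}0\\I_2\end{bmatrix}u,\qquad H(q,p)=\tfrac12p^\top M^{-1}(q_{l_2})p+\tfrac12(q_l-q_m)^\top K_s(q_l-q_m).$$ Fix a reference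 $q_*\in\mathbb R^2$ and constants $\alpha_{j_i},\beta_{j_i}>0$ ($j\in\{l,m,\sigma\}$, $i=1,2$) and $k_{\sigma_1},k_{\sigma_2}>0$. Let $\Phi_j(z)=\sum_{i=1}^2\frac{\alpha_{j_i}}{\beta_{j_i}}\ln\cosh(\beta_{j_i}z_i)$, $K_\sigma=\mathrm{diag}\{k_{\sigma_1},k_{\sigma_2}\}$, and let $R_{c_l},R_{c_m},K_c\in\mathbb R^{2\times2}$ be symmetric positive definite with $R_{c_l}-\frac14(D_l^{-1}+D_m^{-1})>0$. With controller states $x_{c_l},x_{c_m},\sigma\in\mathbb R^2$ and $z_l=q_l-q_*+x_{c_l}$, $z_m=q_m-q_*+x_{c_m}$, consider $$\dot x_{c_l}=-R_{c_l}\nabla_{x_{c_l}}\Phi_l(z_l),\quad \dot x_{c_m}=-R_{c_m}\left[\nabla_{x_{c_m}}\Phi_m(z_m)+K_cx_{c_m}\right],\quad \dot\sigma=\nabla^2\Phi_\sigma(\sigma)(q_m-q_*)-K_\sigma\sigma,$$ $$u=-\nabla\Phi_l(z_l)-\nabla\Phi_m(z_m)-\nabla\Phi_\sigma(\sigma).$$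 Define $A=\mathrm{diag}\{\beta_{l_1}\alpha_{l_1},\beta_{l_2}\alpha_{l_2},\beta_{m_1}\alpha_{m_1},\beta_{m_2}\alpha_{m_2}\}$, $A_\sigma=\mathrm{diag}\{\beta_{\sigma_1}\alpha_{\sigma_1},\beta_{\sigma_2}\alpha_{\sigma_2}\}$, $K_S=\begin{bmatrix}K_s&-K_s\\-K_s&K_s\end{bmatrix}$, $K_C=\mathrm{blkdiag}\{\mathbf 0_{2\times2},K_c\}$, $M_*=M(q_{*_2})$, and, with respect to the splitting $\zeta=(q,p,(x_{c_l},x_{c_m}))$ into three blocks of size $4$, $$F_\zeta=\begin{bmatrix}0&I_4&0\\-I_4&-R_2&\Gamma\\0&0&-\mathrm{blkdiag}\{R_{c_l},R_{c_m}\}\end{bmatrix},\quad \Gamma=\begin{bmatrix}I_2&0\\-I_2&0\end{bmatrix},\quad (\nabla^2H_\zeta)_*=\begin{bmatrix}K_S+A&0&A\\0&M_*^{-1}&0\\A&0&A+K_C\end{bmatrix},$$ $$\mathcal A=\begin{bmatrix}F_\zeta(\nabla^2H_\zeta)_*&A_{\xi_1}\\A_{\xi_2}^\top&-K_\sigma\end{bmatrix},$$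 where $A_{\xi_1}\in\mathbb R^{12\times2}$ has the block $-A_\sigma$ in the rows of $p_m$ and $A_{\xi_2}\in\mathbb R^{12\times2}$ has the block $A_\sigma$ in the rows of $q_m$, all other entries being zero. Then: (i) The inputs are saturated: $-(\alpha_{l_i}+\alpha_{m_i}+\alpha_{\sigma_i})\le u_i\le\alpha_{l_i}+\alpha_{m_i}+\alpha_{\sigma_i}$ for $i=1,2$ and all values of the states. (ii) If $\mathcal A$ is Hurwitz (all its eigenvalues have negative real part), then $\xi_*=(q_l,q_m,p,x_{c_l},x_{c_m},\sigma)=(q_*,q_*,\mathbf 0_4,\mathbf 0_2,\mathbf 0_2,\mathbf 0_2)$ is a locally asymptotically stable equilibrium of the closed-loop system. -/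

import Mathlib

noncomputable section

namespace PlanarRobot

open Matrix

/-! ### Differential operators -/

/-- The gradient `∇f` of a function of finitely many real variables (column of partial
derivatives). -/
def grad {ι : Type*} [Fintype ι] [DecidableEq ι] (f : (ι → ℝ) → ℝ) (x : ι → ℝ) : ι → ℝ :=
  fun i => fderiv ℝ f x (Pi.single i 1)

/-- The Hessian `∇²f`, the Jacobian of `∇f`: its `(i, j)` entry is `∂(∂f/∂xⱼ)/∂xᵢ`. -/
def hess {ι : Type*} [Fintype ι] [DecidableEq ι] (f : (ι → ℝ) → ℝ) (x : ι → ℝ) :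
    Matrix ι ι ℝ :=
  Matrix.of fun i j => fderiv ℝ (fun y => grad f y j) x (Pi.single i 1)

/-! ### Stability notions for autonomous differential equations -/

section Stability

variable {E : Type*} [NormedAddCommGroup E] [NormedSpace ℝ E]

/-- `xs` is an equilibrium of `ẋ = f(x)`. -/
def IsEquilibrium (f : E → E) (xs : E) : Prop := f xs = 0

/-- Lyapunov stability of `xs` for `ẋ = f(x)`: every solution, on whatever interval `[0, T)` it is
defined, stays `ε`-close to `xs` if it starts `δ`-close to `xs`. -/
def IsLyapunovStable (f : E → E) (xs : E) : Prop :=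
  ∀ ε > 0, ∃ δ > 0, ∀ (T : ℝ) (x : ℝ → E), 0 < T →
    IsIntegralCurveOn x (fun _ => f) (Set.Ico 0 T) → ‖x 0 - xs‖ < δ →
      ∀ t ∈ Set.Ico 0 T, ‖x t - xs‖ < ε

/-- Local attractivity of `xs` for `ẋ = f(x)`: from every initial state near `xs` there is a
solution on `[0, ∞)`, and every such solution converges to `xs`. -/
def IsLocallyAttractive (f : E → E) (xs : E) : Prop :=
  ∃ δ > 0, ∀ x₀ : E, ‖x₀ - xs‖ < δ →
    (∃ x : ℝ → E, x 0 = x₀ ∧ IsIntegralCurveOn x (fun _ => f) (Set.Ici 0)) ∧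
    ∀ x : ℝ → E, x 0 = x₀ → IsIntegralCurveOn x (fun _ => f) (Set.Ici 0) →
      Filter.Tendsto x Filter.atTop (nhds xs)

/-- `xs` is a locally asymptotically stable equilibrium of `ẋ = f(x)`. (For finite-dimensional `E`
this does not depend on the norm.) -/
def IsLocallyAsymptoticallyStable (f : E → E) (xs : E) : Prop :=
  IsEquilibrium f xs ∧ IsLyapunovStable f xs ∧ IsLocallyAttractive f xs

end Stability

/-- A real square matrix is Hurwitz if all its complex eigenvalues have negative real part. -/
def IsHurwitz {ι : Type*} [Fintype ι] [DecidableEq ι] (A : Matrix ι ι ℝ) : Prop :=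
  ∀ μ ∈ spectrum ℂ (A.map (algebraMap ℝ ℂ)), μ.re < 0

/-! ### The robot -/

/-- Indices of a pair (links, motors) of vectors of `ℝ²`: `Sum.inl i` is link `i`, `Sum.inr i` is
motor `i`. -/
abbrev Q : Type := Fin 2 ⊕ Fin 2

/-- Indices of `ζ = (q, p, x_c)`, with `x_c = (x_{c_l}, x_{c_m})`. -/
abbrev Z : Type := (Q ⊕ Q) ⊕ Q

/-- Indices of `ξ = (ζ, σ)`. -/
abbrev X : Type := Z ⊕ Fin 2

/-- Physical constants of the robot: `a₁`, `a₂`, `b` (inertia of the links), `Im` (inertia of the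
motors), `Dl`, `Dm` (damping on links and motors), `ks` (springs). -/
structure Robot where
  a₁ : ℝ
  a₂ : ℝ
  b : ℝ
  Im : Fin 2 → ℝ
  Dl : Fin 2 → ℝ
  Dm : Fin 2 → ℝ
  ks : Fin 2 → ℝ

/-- All physical constants are positive. -/
structure Robot.Positive (r : Robot) : Prop where
  a₁ : 0 < r.a₁
  a₂ : 0 < r.a₂
  b : 0 < r.b
  Im : ∀ i, 0 < r.Im i
  Dl : ∀ i, 0 < r.Dl i
  Dm : ∀ i, 0 < r.Dm i
  ks : ∀ i, 0 < r.ks i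

/-- Link inertia matrix `M_l(q_{l₂})`. -/
def Robot.Ml (r : Robot) (θ : ℝ) : Matrix (Fin 2) (Fin 2) ℝ :=
  !![r.a₁ + r.a₂ + 2 * r.b * Real.cos θ, r.a₂ + r.b * Real.cos θ;
     r.a₂ + r.b * Real.cos θ, r.a₂]

/-- Inertia matrix `M(q_{l₂})`. -/
def Robot.M (r : Robot) (θ : ℝ) : Matrix Q Q ℝ :=
  fromBlocks (r.Ml θ) 0 0 (diagonal r.Im)

/-- Damping matrix `R₂ = blkdiag(D_l, D_m)`. -/
def Robot.R₂ (r : Robot) : Matrix Q Q ℝ :=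
  fromBlocks (diagonal r.Dl) 0 0 (diagonal r.Dm)

/-- Stiffness matrix `K_s`. -/
def Robot.Ks (r : Robot) : Matrix (Fin 2) (Fin 2) ℝ := diagonal r.ks

/-- Input matrix `B`. -/
def B : Matrix Q (Fin 2) ℝ := fromRows 0 1

/-- The link part (`q_l`, `x_{c_l}`, …) of a vector of `ℝ⁴`. -/
def lnk (q : Q → ℝ) : Fin 2 → ℝ := fun i => q (Sum.inl i)

/-- The motor part (`q_m`, `x_{c_m}`, …) of a vector of `ℝ⁴`. -/
def mot (q : Q → ℝ) : Fin 2 → ℝ := fun i => q (Sum.inr i)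

/-- Total energy `H(q, p) = ½ pᵀ M⁻¹(q_{l₂}) p + ½ ‖q_l - q_m‖²_{K_s}`. -/
def Robot.H (r : Robot) (q p : Q → ℝ) : ℝ :=
  1 / 2 * (p ⬝ᵥ ((r.M (lnk q 1))⁻¹ *ᵥ p)) +
    1 / 2 * ((lnk q - mot q) ⬝ᵥ (r.Ks *ᵥ (lnk q - mot q)))

/-- The open-loop port-Hamiltonian dynamics: `(q̇, ṗ)` as a function of `q`, `p` and the input `u`. -/
def Robot.dyn (r : Robot) (q p : Q → ℝ) (u : Fin 2 → ℝ) : Q ⊕ Q → ℝ :=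
  fromBlocks 0 1 (-1) (-r.R₂) *ᵥ
      Sum.elim (grad (fun q' => r.H q' p) q) (grad (fun p' => r.H q p') p) +
    fromRows (0 : Matrix Q (Fin 2) ℝ) B *ᵥ u

/-! ### The controller -/

/-- Controller constants; `qs` is the reference `q_*`. -/
structure Controller where
  αl : Fin 2 → ℝ
  αm : Fin 2 → ℝ
  ασ : Fin 2 → ℝ
  βl : Fin 2 → ℝ
  βm : Fin 2 → ℝ
  βσ : Fin 2 → ℝ
  kσ : Fin 2 → ℝ
  Rcl : Matrix (Fin 2) (Fin 2) ℝ
  Rcm : Matrix (Fin 2) (Fin 2) ℝ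
  Kc : Matrix (Fin 2) (Fin 2) ℝ
  qs : Fin 2 → ℝ

/-- The conditions on the controller constants: positivity, and
`R_{c_l} - ¼ (D_l⁻¹ + D_m⁻¹) > 0`. -/
structure Controller.Admissible (c : Controller) (r : Robot) : Prop where
  αl : ∀ i, 0 < c.αl i
  αm : ∀ i, 0 < c.αm i
  ασ : ∀ i, 0 < c.ασ i
  βl : ∀ i, 0 < c.βl i
  βm : ∀ i, 0 < c.βm i
  βσ : ∀ i, 0 < c.βσ i
  kσ : ∀ i, 0 < c.kσ i
  Rcl : c.Rcl.PosDef
  Rcm : c.Rcm.PosDef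
  Kc : c.Kc.PosDef
  schur : (c.Rcl - (1 / 4 : ℝ) • ((diagonal r.Dl)⁻¹ + (diagonal r.Dm)⁻¹)).PosDef

/-- `z ↦ ∑ᵢ (αᵢ / βᵢ) ln(cosh(βᵢ zᵢ))`. -/
def logCosh (α β : Fin 2 → ℝ) (z : Fin 2 → ℝ) : ℝ :=
  ∑ i, α i / β i * Real.log (Real.cosh (β i * z i))

def Controller.Φl (c : Controller) : (Fin 2 → ℝ) → ℝ := logCosh c.αl c.βl

def Controller.Φm (c : Controller) : (Fin 2 → ℝ) → ℝ := logCosh c.αm c.βm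

def Controller.Φσ (c : Controller) : (Fin 2 → ℝ) → ℝ := logCosh c.ασ c.βσ

/-- `K_σ`. -/
def Controller.Kσ (c : Controller) : Matrix (Fin 2) (Fin 2) ℝ := diagonal c.kσ

/-- `z_l(q_l, x_{c_l}) = q_l - q_* + x_{c_l}`. -/
def Controller.zl (c : Controller) (ql xcl : Fin 2 → ℝ) : Fin 2 → ℝ := ql - c.qs + xcl

/-- `z_m(q_m, x_{c_m}) = q_m - q_* + x_{c_m}`. -/
def Controller.zm (c : Controller) (qm xcm : Fin 2 → ℝ) : Fin 2 → ℝ := qm - c.qs + xcm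

/-- The control law `u = -∇Φ_l(z_l) - ∇Φ_m(z_m) - ∇Φ_σ(σ)`; `xc = (x_{c_l}, x_{c_m})`. -/
def Controller.u (c : Controller) (q xc : Q → ℝ) (σ : Fin 2 → ℝ) : Fin 2 → ℝ :=
  -grad c.Φl (c.zl (lnk q) (lnk xc)) - grad c.Φm (c.zm (mot q) (mot xc)) - grad c.Φσ σ

/-- `ẋ_{c_l} = -R_{c_l} ∇_{x_{c_l}} Φ_l(z_l(q_l, x_{c_l}))`. -/
def Controller.dynXcl (c : Controller) (ql xcl : Fin 2 → ℝ) : Fin 2 → ℝ :=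
  -(c.Rcl *ᵥ grad (fun x => c.Φl (c.zl ql x)) xcl)

/-- `ẋ_{c_m} = -R_{c_m} [∇_{x_{c_m}} Φ_m(z_m(q_m, x_{c_m})) + K_c x_{c_m}]`. -/
def Controller.dynXcm (c : Controller) (qm xcm : Fin 2 → ℝ) : Fin 2 → ℝ :=
  -(c.Rcm *ᵥ (grad (fun x => c.Φm (c.zm qm x)) xcm + c.Kc *ᵥ xcm))

/-- `σ̇ = ∇²Φ_σ(σ) (q_m - q_*) - K_σ σ`. -/
def Controller.dynσ (c : Controller) (qm σ : Fin 2 → ℝ) : Fin 2 → ℝ :=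
  hess c.Φσ σ *ᵥ (qm - c.qs) - c.Kσ *ᵥ σ

/-! ### The closed loop -/

/-- The blocks `q`, `p`, `x_c`, `σ` of the closed-loop state `ξ`. -/
def qOf (ξ : X → ℝ) : Q → ℝ := fun i => ξ (Sum.inl (Sum.inl (Sum.inl i)))

def pOf (ξ : X → ℝ) : Q → ℝ := fun i => ξ (Sum.inl (Sum.inl (Sum.inr i)))

def xcOf (ξ : X → ℝ) : Q → ℝ := fun i => ξ (Sum.inl (Sum.inr i))

def σOf (ξ : X → ℝ) : Fin 2 → ℝ := fun i => ξ (Sum.inr i)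

/-- The closed-loop vector field, `ξ̇ = closedLoop ξ`. -/
def closedLoop (r : Robot) (c : Controller) (ξ : X → ℝ) : X → ℝ :=
  Sum.elim
    (Sum.elim
      (r.dyn (qOf ξ) (pOf ξ) (c.u (qOf ξ) (xcOf ξ) (σOf ξ)))
      (Sum.elim
        (c.dynXcl (lnk (qOf ξ)) (lnk (xcOf ξ)))
        (c.dynXcm (mot (qOf ξ)) (mot (xcOf ξ)))))
    (c.dynσ (mot (qOf ξ)) (σOf ξ))

/-- `ξ_* = (q_*, q_*, 0)`. -/
def ξs (c : Controller) : X → ℝ :=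
  Sum.elim (Sum.elim (Sum.elim (Sum.elim c.qs c.qs) 0) 0) 0

/-! ### The matrix `𝒜` -/

/-- `F_ζ`; its `(p, x_c)` block is `[Γ_ζ 0]` with `Γ_ζ = [I; -I]`. -/
def Fζ (r : Robot) (c : Controller) : Matrix Z Z ℝ :=
  fromBlocks
    (fromBlocks 0 1 (-1) (-r.R₂)) (fromRows 0 (fromBlocks 1 0 (-1) 0))
    0 (fromBlocks (-c.Rcl) 0 0 (-c.Rcm))

/-- `A = diag(β_l α_l, β_m α_m)`. -/
def Controller.A (c : Controller) : Matrix Q Q ℝ :=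
  fromBlocks (diagonal fun i => c.βl i * c.αl i) 0 0 (diagonal fun i => c.βm i * c.αm i)

/-- `K_S = [K_s, -K_s; -K_s, K_s]`. -/
def Robot.KS (r : Robot) : Matrix Q Q ℝ := fromBlocks r.Ks (-r.Ks) (-r.Ks) r.Ks

/-- `K_C = blkdiag(0, K_c)`. -/
def Controller.KC (c : Controller) : Matrix Q Q ℝ := fromBlocks 0 0 0 c.Kc

/-- `(∇²H_ζ)_*`, the Hessian at `ζ_* = (q_*, q_*, 0)` of
`H_ζ = H(q, p) + Φ_l(z_l) + Φ_m(z_m) + ½ ‖x_{c_m}‖²_{K_c}`, in explicit form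
`[K_S + A, 0, A; 0, M_*⁻¹, 0; A, 0, A + K_C]`. -/
def hessHζ (r : Robot) (c : Controller) : Matrix Z Z ℝ :=
  fromBlocks
    (fromBlocks (r.KS + c.A) 0 0 (r.M (c.qs 1))⁻¹) (fromRows c.A 0)
    (fromCols c.A 0) (c.A + c.KC)

/-- `A_σ`. -/
def Controller.Aσ (c : Controller) : Matrix (Fin 2) (Fin 2) ℝ :=
  diagonal fun i => c.βσ i * c.ασ i

/-- `A_{ξ₁}`: `-A_σ` in the rows of `p_m`, zero elsewhere. -/
def Controller.Aξ₁ (c : Controller) : Matrix Z (Fin 2) ℝ :=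
  fromRows (fromRows 0 (fromRows 0 (-c.Aσ))) 0

/-- `A_{ξ₂}`: `A_σ` in the rows of `q_m`, zero elsewhere. -/
def Controller.Aξ₂ (c : Controller) : Matrix Z (Fin 2) ℝ :=
  fromRows (fromRows (fromRows 0 c.Aσ) 0) 0

/-- `𝒜`. -/
def 𝒜 (r : Robot) (c : Controller) : Matrix X X ℝ :=
  fromBlocks (Fζ r c * hessHζ r c) c.Aξ₁ c.Aξ₂ᵀ (-c.Kσ)

end PlanarRobot

end

/-! Each component of `u` is a sum of three terms `α tanh(β ·)` up to sign, and `|tanh| ≤ 1`; this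
gives (i). Part (ii) is Lyapunov's indirect method, in two halves.

General half (`isLocallyAsymptoticallyStable_of_isHurwitz`). The Cayley transform `T = (1 + A)(1 -
A)⁻¹` sends the left half-plane into the unit disc, so Gelfand's formula gives `T ^ n → 0`. A finite
sum of the squares `|T ^ j x|²` then decreases under `T`, and polarization turns this into a
quadratic form `B` with `B(x, A x) ≤ -c ‖x‖²` (`IsHurwitz.exists_lyapunov`). Near the equilibrium
the linearization error costs only part of `c`, so `B` decays exponentially along solutions
(`lyapunov_decay`). Existence for all positive times comes from a bounded Lipschitz cutoff of the
field.

Specific half. The closed loop must have derivative `𝒜` at `ξ_*`. Evaluating the gradients gives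
`explicitField`, valid where `M` is invertible; invertibility at the reference follows from `𝒜`
being Hurwitz. The field is smooth there, so directional derivatives suffice to identify its
derivative. -/

noncomputable section

namespace PlanarRobot

open Matrix

/-! ### Quadratic Lyapunov functions of Hurwitz matrices, via the Cayley transform. -/

section Cayley

/-- If the spectrum of `a` lies in the open left half-plane, the spectrum of its Cayley transform
`(1 + a) (1 - a)⁻¹` lies in the open unit disc. -/
theorem norm_lt_one_of_mem_spectrum_cayley {R : Type*} [Ring R] [Algebra ℂ R] {a : R}
    (ha : ∀ μ ∈ spectrum ℂ a, μ.re < 0) (u : Rˣ) (hu : (u : R) = 1 - a) {z : ℂ}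
    (hz : z ∈ spectrum ℂ ((1 + a) * ↑u⁻¹)) : ‖z‖ < 1 := by
  by_contra! hn
  refine hz ?_
  -- For `z ≠ -1` invertibility reduces to that of `w - a` with `w = (z - 1)/(z + 1)`, whose real
  -- part `(|z|² - 1)/|z + 1|²` is nonnegative when `‖z‖ ≥ 1`. For `z = -1` the first factor is the
  -- scalar `-2`.
  have key : algebraMap ℂ R z - (1 + a) * ↑u⁻¹ =
      (algebraMap ℂ R (z - 1) - (z + 1) • a) * ↑u⁻¹ := by
    have h : algebraMap ℂ R z = algebraMap ℂ R z * (u : R) * ↑u⁻¹ := by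
      rw [mul_assoc, Units.mul_inv, mul_one]
    rw [h, ← sub_mul, hu]
    congr 1
    simp only [Algebra.smul_def, map_sub, map_add, map_one]
    noncomm_ring
  rw [spectrum.mem_resolventSet_iff, key]
  refine IsUnit.mul ?_ (Units.isUnit _)
  by_cases h1 : z + 1 = 0
  · rw [h1, zero_smul, sub_zero]
    refine (IsUnit.mk0 (z - 1) fun h => ?_).map (algebraMap ℂ R)
    have : (2 : ℂ) = (z + 1) - (z - 1) := by ring
    rw [h1, h] at this
    norm_num at this
  · have hw : (z - 1) / (z + 1) ∉ spectrum ℂ a := by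
      intro hmem
      have hlt := ha _ hmem
      rw [Complex.div_re, ← add_div] at hlt
      have h2 : 1 ≤ Complex.normSq z := by
        rw [Complex.normSq_eq_norm_sq]; nlinarith
      rw [Complex.normSq_apply] at h2
      refine absurd hlt (not_lt.mpr (div_nonneg ?_ (Complex.normSq_nonneg _)))
      simp
      nlinarith
    rw [spectrum.notMem_iff] at hw
    have : algebraMap ℂ R (z - 1) - (z + 1) • a =
        algebraMap ℂ R (z + 1) * (algebraMap ℂ R ((z - 1) / (z + 1)) - a) := by
      rw [mul_sub, ← map_mul, mul_div_cancel₀ _ h1, Algebra.smul_def]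
    rw [this]
    exact ((IsUnit.mk0 _ h1).map (algebraMap ℂ R)).mul hw

end Cayley

/-- Powers of an element of spectral radius `< 1` tend to zero. -/
theorem tendsto_pow_of_spectrum_norm_lt_one {R : Type*} [NormedRing R] [NormedAlgebra ℂ R]
    [CompleteSpace R] [Nontrivial R] {a : R} (ha : ∀ z ∈ spectrum ℂ a, ‖z‖ < 1) :
    Filter.Tendsto (fun n : ℕ => ‖a ^ n‖) Filter.atTop (nhds 0) := by
  have h1 : spectralRadius ℂ a < (1 : NNReal) :=
    spectrum.spectralRadius_lt_of_forall_lt a fun z hz => by exact_mod_cast ha z hz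
  obtain ⟨r, hr1, hr2⟩ := ENNReal.lt_iff_exists_nnreal_btwn.mp h1
  -- Gelfand's formula: `‖a ^ n‖ ≤ r ^ n` eventually, for some `r < 1`.
  have h2 := (spectrum.pow_nnnorm_pow_one_div_tendsto_nhds_spectralRadius a).eventually_lt_const hr1
  have hr : (r : ℝ) < 1 := by exact_mod_cast hr2
  refine squeeze_zero' (Filter.Eventually.of_forall fun n => norm_nonneg _) ?_
    (tendsto_pow_atTop_nhds_zero_of_lt_one r.2 hr)
  filter_upwards [h2, Filter.eventually_ge_atTop 1] with n hn hn1
  have hn0 : (0 : ℝ) < n := by exact_mod_cast hn1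
  have := ENNReal.rpow_le_rpow hn.le hn0.le
  rw [← ENNReal.rpow_mul, one_div, inv_mul_cancel₀ hn0.ne', ENNReal.rpow_one,
    ENNReal.rpow_natCast] at this
  exact_mod_cast this

section Lyapunov

open scoped Matrix.Norms.Operator

/-- The norm on `ι → ℝ` is the sup norm; this bound and the next compare it with the Euclidean one.
-/
theorem sq_norm_le_dotProduct_self {ι : Type*} [Fintype ι] (x : ι → ℝ) : ‖x‖ ^ 2 ≤ x ⬝ᵥ x := by
  have h0 : 0 ≤ x ⬝ᵥ x := Finset.sum_nonneg fun i _ => mul_self_nonneg _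
  have : ‖x‖ ≤ √(x ⬝ᵥ x) := by
    refine (pi_norm_le_iff_of_nonneg (Real.sqrt_nonneg _)).mpr fun i => ?_
    refine Real.abs_le_sqrt ?_
    rw [pow_two]
    exact Finset.single_le_sum (f := fun i => x i * x i) (fun i _ => mul_self_nonneg _)
      (Finset.mem_univ i)
  calc ‖x‖ ^ 2 ≤ √(x ⬝ᵥ x) ^ 2 := by gcongr
    _ = _ := Real.sq_sqrt h0

theorem dotProduct_self_le {ι : Type*} [Fintype ι] (x : ι → ℝ) : x ⬝ᵥ x ≤ Fintype.card ι * ‖x‖ ^ 2 := by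
  calc x ⬝ᵥ x ≤ ∑ _i : ι, ‖x‖ ^ 2 := by
        refine Finset.sum_le_sum fun i _ => ?_
        rw [← pow_two, ← sq_abs]
        gcongr
        exact norm_le_pi_norm x i
    _ = _ := by simp

/-- The real Cayley transform of a Hurwitz matrix has powers tending to zero. -/
theorem IsHurwitz.exists_cayley {ι : Type*} [Fintype ι] [DecidableEq ι] [Nonempty ι] {A : Matrix ι ι ℝ} (hA : IsHurwitz A) :
    IsUnit (1 - A).det ∧
      Filter.Tendsto (fun n : ℕ => ‖((1 + A) * (1 - A)⁻¹) ^ n‖) Filter.atTop (nhds 0) := by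
  set φ := (algebraMap ℝ ℂ).mapMatrix (m := ι) with hφ
  have hφA : φ A = A.map (algebraMap ℝ ℂ) := rfl
  have h1 : IsUnit (1 - φ A) := by
    have : (1 : ℂ) ∉ spectrum ℂ (φ A) := fun h => by
      have := hA 1 h
      norm_num at this
    simpa [spectrum.notMem_iff] using this
  have hdet : IsUnit (1 - A).det := by
    have h2 : (1 - φ A) = φ (1 - A) := by rw [map_sub, map_one]
    rw [h2, Matrix.isUnit_iff_isUnit_det, ← RingHom.map_det] at h1
    exact (isUnit_map_iff (algebraMap ℝ ℂ) _).mp h1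
  refine ⟨hdet, ?_⟩
  -- Spectral theory is over `ℂ`; the row-sum norm is unchanged by complexification, so the limit
  -- descends to `ℝ`.
  have hnorm : ∀ C : Matrix ι ι ℝ, ‖φ C‖ = ‖C‖ := fun C => by
    simp [hφ, linfty_opNorm_def]
  obtain ⟨u, hu⟩ := h1
  have huinv : (↑u⁻¹ : Matrix ι ι ℂ) = φ (1 - A)⁻¹ := by
    refine Units.inv_eq_of_mul_eq_one_right ?_
    rw [hu, ← map_one φ, ← map_sub, ← map_mul, Matrix.mul_nonsing_inv _ hdet]
  have key := tendsto_pow_of_spectrum_norm_lt_one (a := (1 + φ A) * (↑u⁻¹ : Matrix ι ι ℂ))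
    fun z hz => norm_lt_one_of_mem_spectrum_cayley hA u hu hz
  refine key.congr fun n => ?_
  rw [← hnorm, map_pow, map_mul, map_add, map_one, huinv]

/-- **Lyapunov's theorem**: a Hurwitz matrix admits a quadratic Lyapunov function. -/
theorem IsHurwitz.exists_lyapunov {ι : Type*} [Fintype ι] [DecidableEq ι] [Nonempty ι] {A : Matrix ι ι ℝ} (hA : IsHurwitz A) :
    ∃ B : (ι → ℝ) →L[ℝ] (ι → ℝ) →L[ℝ] ℝ, (∀ x y, B x y = B y x) ∧ (∀ x, ‖x‖ ^ 2 ≤ B x x) ∧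
      ∃ c > 0, ∀ x, B x (A *ᵥ x) ≤ -c * ‖x‖ ^ 2 := by
  obtain ⟨hdet, hT⟩ := hA.exists_cayley
  set T := (1 + A) * (1 - A)⁻¹ with hTdef
  set k : ℝ := (Fintype.card ι : ℝ)
  have hlim : Filter.Tendsto (fun n : ℕ => k * ‖T ^ n‖ ^ 2) Filter.atTop (nhds 0) := by
    simpa using (hT.pow 2).const_mul k
  -- One `N` with `k ‖T ^ N‖² < 1/2` is enough: a sum over `j < N` replaces the usual infinite
  -- series. `N ≥ 1` keeps the term `j = 0`, which gives the lower bound `‖x‖²`.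
  obtain ⟨N, hN, hN1⟩ := ((hlim.eventually_lt_const (show (0 : ℝ) < 1 / 2 by norm_num)).and
    (Filter.eventually_ge_atTop 1)).exists
  let β : (ι → ℝ) →ₗ[ℝ] (ι → ℝ) →ₗ[ℝ] ℝ := LinearMap.mk₂ ℝ
    (fun x y => ∑ j ∈ Finset.range N, (T ^ j *ᵥ x) ⬝ᵥ (T ^ j *ᵥ y))
    (fun x x' y => by simp [mulVec_add, add_dotProduct, Finset.sum_add_distrib])
    (fun c x y => by simp [mulVec_smul, Finset.mul_sum])
    (fun x y y' => by simp [mulVec_add, dotProduct_add, Finset.sum_add_distrib])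
    (fun c x y => by simp [mulVec_smul, Finset.mul_sum])
  have hβ : ∀ x y, β x y = ∑ j ∈ Finset.range N, (T ^ j *ᵥ x) ⬝ᵥ (T ^ j *ᵥ y) :=
    fun x y => rfl
  have hsymm : ∀ x y, β x y = β y x := fun x y => by
    simp only [hβ]
    exact Finset.sum_congr rfl fun j _ => dotProduct_comm _ _
  have hdec : ∀ y, β (T *ᵥ y) (T *ᵥ y) ≤ β y y - 1 / 2 * ‖y‖ ^ 2 := by
    intro y
    -- Applying `T` shifts the sum by one, so the difference telescopes.
    have h1 : β (T *ᵥ y) (T *ᵥ y) - β y y = (T ^ N *ᵥ y) ⬝ᵥ (T ^ N *ᵥ y) - y ⬝ᵥ y := by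
      simp only [hβ, mulVec_mulVec, ← pow_succ]
      rw [← Finset.sum_sub_distrib,
        Finset.sum_range_sub (fun j => (T ^ j *ᵥ y) ⬝ᵥ (T ^ j *ᵥ y))]
      simp
    have h2 : (T ^ N *ᵥ y) ⬝ᵥ (T ^ N *ᵥ y) ≤ 1 / 2 * ‖y‖ ^ 2 := by
      calc _ ≤ k * ‖T ^ N *ᵥ y‖ ^ 2 := dotProduct_self_le _
        _ ≤ k * (‖T ^ N‖ * ‖y‖) ^ 2 := by
            gcongr
            exact linfty_opNorm_mulVec _ _
        _ = (k * ‖T ^ N‖ ^ 2) * ‖y‖ ^ 2 := by ring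
        _ ≤ _ := by gcongr
    linarith [sq_norm_le_dotProduct_self y]
  refine ⟨β.toContinuousBilinearMap, hsymm, fun x => ?_, ?_⟩
  · rw [LinearMap.toContinuousBilinearMap_apply, hβ]
    refine (sq_norm_le_dotProduct_self x).trans ?_
    refine le_of_eq_of_le ?_ (Finset.single_le_sum
      (f := fun j => (T ^ j *ᵥ x) ⬝ᵥ (T ^ j *ᵥ x))
      (fun j _ => Finset.sum_nonneg fun i _ => mul_self_nonneg _) (Finset.mem_range.mpr hN1))
    simp
  · set S := (1 - A)⁻¹ with hS
    have hS1 : S * (1 - A) = 1 := Matrix.nonsing_inv_mul _ hdet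
    -- With `y = (1 - A) w` and `T y = (1 + A) w`, polarization gives `β(y, y) - β(T y, T y) = -4
    -- β(w, A w)`. The `1/8` is the decrease `1/2` divided by this `4`; the rest comes from `w = S
    -- y`.
    refine ⟨1 / (8 * (‖S‖ ^ 2 + 1)), by positivity, fun w => ?_⟩
    rw [LinearMap.toContinuousBilinearMap_apply]
    have hy : S *ᵥ ((1 - A) *ᵥ w) = w := by rw [mulVec_mulVec, hS1, one_mulVec]
    have hTy : T *ᵥ ((1 - A) *ᵥ w) = (1 + A) *ᵥ w := by
      rw [hTdef, ← mulVec_mulVec, hy]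
    have h1 := hdec ((1 - A) *ᵥ w)
    rw [hTy] at h1
    have hw : ‖w‖ ^ 2 ≤ (‖S‖ ^ 2 + 1) * ‖(1 - A) *ᵥ w‖ ^ 2 := by
      calc ‖w‖ ^ 2 = ‖S *ᵥ ((1 - A) *ᵥ w)‖ ^ 2 := by rw [hy]
        _ ≤ (‖S‖ * ‖(1 - A) *ᵥ w‖) ^ 2 := by
            gcongr
            exact linfty_opNorm_mulVec _ _
        _ ≤ _ := by nlinarith [sq_nonneg ‖(1 - A) *ᵥ w‖]
    have h2 : β ((1 - A) *ᵥ w) ((1 - A) *ᵥ w) - β ((1 + A) *ᵥ w) ((1 + A) *ᵥ w) =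
        -4 * β w (A *ᵥ w) := by
      simp only [add_mulVec, sub_mulVec, one_mulVec, map_add, map_sub, LinearMap.add_apply,
        LinearMap.sub_apply]
      rw [hsymm (A *ᵥ w) w]
      ring
    have h3 : 1 / (8 * (‖S‖ ^ 2 + 1)) * ‖w‖ ^ 2 ≤ 1 / 8 * ‖(1 - A) *ᵥ w‖ ^ 2 := by
      rw [div_mul_eq_mul_div, div_le_iff₀ (by positivity)]
      linarith
    linarith

end Lyapunov

end PlanarRobot

/-! ### Lyapunov's indirect method for a general vector field. -/

namespace PlanarRobot

open Matrix Set Metric Filter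
open scoped NNReal

section GlobalExistence

variable {E : Type*} [NormedAddCommGroup E] [NormedSpace ℝ E]

/-- A bounded Lipschitz vector field on a Banach space is complete. -/
theorem exists_isIntegralCurve_of_lipschitz_of_bounded [CompleteSpace E] {g : E → E} {K L : ℝ≥0}
    (hK : LipschitzWith K g) (hL : ∀ x, ‖g x‖ ≤ L) (x₀ : E) :
    ∃ x : ℝ → E, x 0 = x₀ ∧ IsIntegralCurve x (fun _ => g) := by
  have hloc : ∀ n : ℕ, ∃ γ : ℝ → E, γ 0 = x₀ ∧
      ∀ t ∈ Ioo (-(n : ℝ)) n, HasDerivAt γ (g (γ t)) t := by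
    intro n
    -- A field bounded by `L` moves a point at most `L n` in time `n`, so Picard–Lindelöf applies on
    -- all of `[-n, n]` with ball radius `L n`.
    have hP : IsPicardLindelof (fun _ => g)
        (⟨0, by constructor <;> simp⟩ : Icc (-(n : ℝ)) n) x₀ (L * n) 0 L K :=
      .of_time_independent (fun x _ => hL x) hK.lipschitzOnWith (by simp)
    obtain ⟨γ, h0, hγ⟩ := hP.exists_eq_forall_mem_Icc_hasDerivWithinAt₀
    exact ⟨γ, h0, fun t ht => (hγ t (Ioo_subset_Icc_self ht)).hasDerivAt (Icc_mem_nhds ht.1 ht.2)⟩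
  choose γ hγ0 hγ using hloc
  have heq : ∀ m n : ℕ, 0 < m → m ≤ n → EqOn (γ m) (γ n) (Ioo (-(m : ℝ)) m) := by
    intro m n hm hmn
    have hm' : (0 : ℝ) < m := by exact_mod_cast hm
    have hmn' : (m : ℝ) ≤ n := by exact_mod_cast hmn
    exact ODE_solution_unique_of_mem_Ioo (v := fun _ => g) (s := fun _ => univ) (t₀ := 0)
      (fun t _ => hK.lipschitzOnWith) ⟨by linarith, hm'⟩
      (fun t ht => ⟨hγ m t ht, trivial⟩)
      (fun t ht => ⟨hγ n t (Ioo_subset_Ioo (by linarith) hmn' ht), trivial⟩)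
      (by rw [hγ0, hγ0])
  have hmem : ∀ t : ℝ, t ∈ Ioo (-((⌊|t|⌋₊ + 1 : ℕ) : ℝ)) ((⌊|t|⌋₊ + 1 : ℕ) : ℝ) := fun t => by
    rw [mem_Ioo, ← abs_lt]
    exact_mod_cast Nat.lt_floor_add_one |t|
  have hglue : ∀ n : ℕ, ∀ t ∈ Ioo (-(n : ℝ)) n, γ (⌊|t|⌋₊ + 1) t = γ n t := by
    intro n t ht
    have hn : 0 < n := by
      have : (0 : ℝ) < n := by linarith [ht.1, ht.2]
      exact_mod_cast this
    rcases le_total (⌊|t|⌋₊ + 1) n with h | h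
    · exact heq _ _ (Nat.succ_pos _) h (hmem t)
    · exact (heq _ _ hn h ht).symm
  -- The local solutions agree by uniqueness; at time `t` the index `⌊|t|⌋ + 1` is large enough.
  refine ⟨fun t => γ (⌊|t|⌋₊ + 1) t, hγ0 _, fun t => ?_⟩
  refine (hγ _ t (hmem t)).congr_of_eventuallyEq ?_
  filter_upwards [isOpen_Ioo.mem_nhds (hmem t)] with s hs using hglue _ s hs

end GlobalExistence

section Decay

variable {E : Type*} [NormedAddCommGroup E] [NormedSpace ℝ E]

/-- Exponential decay of a strict quadratic Lyapunov function along solutions starting in a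
sublevel set contained in the ball on which it is strict. -/
theorem lyapunov_decay {B : E →L[ℝ] E →L[ℝ] ℝ} (hsymm : ∀ x y, B x y = B y x)
    (hpos : ∀ x, ‖x‖ ^ 2 ≤ B x x) {f : E → E} {xs : E} {r μ : ℝ} (hr : 0 < r) (hμ : 0 < μ)
    (hf : ∀ w, ‖w‖ < r → B w (f (xs + w)) ≤ -μ * B w w) {v T : ℝ} (hv : 0 < v) (hvr : v < r ^ 2)
    {x : ℝ → E} (hx : IsIntegralCurveOn x (fun _ => f) (Ico 0 T))
    (hx0 : B (x 0 - xs) (x 0 - xs) ≤ v) :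
    ∀ t ∈ Ico 0 T, B (x t - xs) (x t - xs) ≤ v * Real.exp (-μ * t) := by
  intro t ht
  set V : ℝ → ℝ := fun s => B (x s - xs) (x s - xs) with hV
  have hsub : Icc 0 t ⊆ Ico 0 T := fun s hs => ⟨hs.1, hs.2.trans_lt ht.2⟩
  have hd : ∀ s ∈ Ico 0 T, HasDerivWithinAt V (2 * B (x s - xs) (f (x s))) (Ico 0 T) s := by
    intro s hs
    have h1 : HasDerivWithinAt (fun s => x s - xs) (f (x s)) (Ico 0 T) s := (hx s hs).sub_const xs
    convert! B.hasDerivWithinAt_of_bilinear h1 h1 using 1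
    rw [hsymm (f (x s))]
    ring
  have hcont : ContinuousOn V (Icc 0 t) := fun s hs =>
    ((hd s (hsub hs)).continuousWithinAt).mono hsub
  -- The comparison is needed only at times when `V` meets the barrier `v exp(-μ t)`. There `V ≤ v <
  -- r²` puts the state in the ball where `hf` holds, so no prior invariance argument is needed, and
  -- `V' ≤ -2μV < -μV` is the strict inequality required.
  refine image_le_of_deriv_right_lt_deriv_boundary (f := V)
    (f' := fun s => 2 * B (x s - xs) (f (x s))) (a := 0) (b := t)
    (B := fun s => v * Real.exp (-μ * s)) (B' := fun s => v * (Real.exp (-μ * s) * (-μ)))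
    hcont (fun s hs => ?_) (by simpa [hV] using hx0) (fun s => ?_) (fun s hs hVs => ?_)
    (right_mem_Icc.mpr ht.1)
  · have hsT : s ∈ Ico 0 T := hsub (Ico_subset_Icc_self hs)
    refine (hd s hsT).mono_of_mem_nhdsWithin ?_
    exact mem_of_superset (Ico_mem_nhdsGE hsT.2) (Ico_subset_Ico_left hs.1)
  · have h1 : HasDerivAt (fun s : ℝ => -μ * s) (-μ) s := by
      simpa using (hasDerivAt_id s).const_mul (-μ)
    exact h1.exp.const_mul v
  · have hVpos : 0 < V s := by rw [hVs]; positivity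
    have hexp : Real.exp (-μ * s) ≤ 1 := Real.exp_le_one_iff.mpr (by nlinarith [hs.1])
    have hVr : V s < r ^ 2 := by rw [hVs]; nlinarith
    have hw : ‖x s - xs‖ < r := lt_of_pow_lt_pow_left₀ 2 hr.le ((hpos _).trans_lt hVr)
    have h1 := hf _ hw
    rw [add_sub_cancel] at h1
    change 2 * B (x s - xs) (f (x s)) < v * (Real.exp (-μ * s) * (-μ))
    have h2 : v * (Real.exp (-μ * s) * (-μ)) = -μ * V s := by rw [hVs]; ring
    rw [h2]
    change _ ≤ -μ * V s at h1
    nlinarith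

end Decay

section Clamp

variable {ι : Type*} [Fintype ι]

/-- The nearest-point retraction onto the cube of half-width `r` centred at `c`. -/
def clamp (c : ι → ℝ) (r : ℝ) (x : ι → ℝ) : ι → ℝ := fun i => max (c i - r) (min (c i + r) (x i))

theorem clamp_mem_closedBall (c : ι → ℝ) {r : ℝ} (hr : 0 ≤ r) (x : ι → ℝ) :
    clamp c r x ∈ closedBall c r := by
  rw [mem_closedBall, dist_pi_le_iff hr]
  intro i
  rw [Real.dist_eq, abs_le]
  have h1 : c i - r ≤ clamp c r x i := le_max_left _ _
  have h2 : clamp c r x i ≤ c i + r := max_le (by linarith) (min_le_left _ _)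
  constructor <;> linarith

theorem clamp_of_mem_closedBall {c : ι → ℝ} {r : ℝ} {x : ι → ℝ} (hx : x ∈ closedBall c r) :
    clamp c r x = x := by
  ext i
  have h := (dist_le_pi_dist x c i).trans hx
  rw [Real.dist_eq, abs_le] at h
  rw [clamp, min_eq_right (by linarith), max_eq_right (by linarith)]

theorem lipschitzWith_clamp (c : ι → ℝ) (r : ℝ) : LipschitzWith 1 (clamp c r) := by
  refine LipschitzWith.of_dist_le_mul fun x y => ?_
  rw [NNReal.coe_one, one_mul]
  refine (dist_pi_le_iff dist_nonneg).mpr fun i => ?_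
  refine le_trans ?_ (dist_le_pi_dist x y i)
  have h := ((LipschitzWith.id.const_min (c i + r)).const_max (c i - r)).dist_le_mul (x i) (y i)
  rwa [NNReal.coe_one, one_mul] at h

end Clamp

/-- **Lyapunov's indirect method**: if `f` is Lipschitz near `xs`, `f xs = 0` and the linearization
of `f` at `xs` is Hurwitz, then `xs` is a locally asymptotically stable equilibrium. -/
theorem isLocallyAsymptoticallyStable_of_isHurwitz {ι : Type*} [Fintype ι] [DecidableEq ι]
    [Nonempty ι] {f : (ι → ℝ) → (ι → ℝ)} {xs : ι → ℝ} {A : Matrix ι ι ℝ} (h0 : f xs = 0)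
    (hd : HasFDerivAt f (Matrix.mulVecLin A).toContinuousLinearMap xs)
    (hl : ∃ K : ℝ≥0, ∃ s ∈ nhds xs, LipschitzOnWith K f s) (hA : IsHurwitz A) :
    IsLocallyAsymptoticallyStable f xs := by
  obtain ⟨B, hsymm, hpos, c, hc, hBA⟩ := hA.exists_lyapunov
  have hBnn : 0 ≤ ‖B‖ := norm_nonneg B
  -- Chosen so that `‖B‖ μ ≤ c/2`: half of `c` absorbs the linearization error, the other half
  -- dominates `μ B(w, w)`.
  set μ := c / (2 * (‖B‖ + 1)) with hμ
  have hμpos : 0 < μ := by positivity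
  obtain ⟨K, s, hs, hK⟩ := hl
  have hlin := (hasFDerivAt_iff_isLittleO_nhds_zero.mp hd).def hμpos
  obtain ⟨r₁, hr₁, hlin⟩ := Metric.eventually_nhds_iff.mp hlin
  obtain ⟨r₂, hr₂, hball⟩ := Metric.nhds_basis_closedBall.mem_iff.mp hs
  set r := min r₁ r₂ with hr
  have hrpos : 0 < r := lt_min hr₁ hr₂
  have hBle : ∀ x y, B x y ≤ ‖B‖ * ‖x‖ * ‖y‖ := fun x y =>
    (le_abs_self _).trans (B.le_opNorm₂ x y)
  have hf : ∀ w, ‖w‖ < r → B w (f (xs + w)) ≤ -μ * B w w := by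
    intro w hw
    have h1 := hlin (y := w) (by simpa using hw.trans_le (min_le_left _ _))
    rw [h0, sub_zero] at h1
    change ‖f (xs + w) - A *ᵥ w‖ ≤ μ * ‖w‖ at h1
    have h2 : B w (f (xs + w)) = B w (A *ᵥ w) + B w (f (xs + w) - A *ᵥ w) := by
      rw [← map_add, add_sub_cancel]
    have h3 : B w (f (xs + w) - A *ᵥ w) ≤ ‖B‖ * ‖w‖ * (μ * ‖w‖) :=
      (hBle _ _).trans (by gcongr)
    have h4 : ‖B‖ * μ ≤ c / 2 := by
      rw [hμ, mul_div_assoc', div_le_div_iff₀ (by positivity) (by norm_num)]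
      nlinarith
    have h5 : μ * B w w ≤ c / 2 * ‖w‖ ^ 2 := by
      calc μ * B w w ≤ μ * (‖B‖ * ‖w‖ * ‖w‖) := by gcongr; exact hBle _ _
        _ = (‖B‖ * μ) * ‖w‖ ^ 2 := by ring
        _ ≤ _ := by gcongr
    have h6 : ‖B‖ * ‖w‖ * (μ * ‖w‖) ≤ c / 2 * ‖w‖ ^ 2 := by
      calc _ = (‖B‖ * μ) * ‖w‖ ^ 2 := by ring
        _ ≤ _ := by gcongr
    linarith [hBA w]
  have hsmall : ∀ v > 0, ∃ δ > 0, ∀ w, ‖w‖ < δ → B w w ≤ v := by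
    intro v hv
    refine ⟨√(v / (‖B‖ + 1)), by positivity, fun w hw => ?_⟩
    have h1 : ‖w‖ ^ 2 < v / (‖B‖ + 1) := by
      rw [← Real.sq_sqrt (show 0 ≤ v / (‖B‖ + 1) by positivity)]
      gcongr
    rw [lt_div_iff₀ (by positivity)] at h1
    nlinarith [hBle w w, sq_nonneg ‖w‖]
  have hstay : ∀ v > 0, v < r ^ 2 → ∀ (T : ℝ) (x : ℝ → ι → ℝ),
      IsIntegralCurveOn x (fun _ => f) (Ico 0 T) → B (x 0 - xs) (x 0 - xs) ≤ v →
        ∀ t ∈ Ico 0 T, ‖x t - xs‖ ^ 2 ≤ v * Real.exp (-μ * t) :=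
    fun v hv hvr T x hx hx0 t ht =>
      (hpos _).trans (lyapunov_decay hsymm hpos hrpos hμpos hf hv hvr hx hx0 t ht)
  have hexp : ∀ t : ℝ, 0 ≤ t → Real.exp (-μ * t) ≤ 1 := fun t ht =>
    Real.exp_le_one_iff.mpr (by nlinarith)
  refine ⟨h0, fun ε hε => ?_, ?_⟩
  · set ρ := min ε r with hρ
    have hρpos : 0 < ρ := lt_min hε hrpos
    have hρr : ρ ^ 2 ≤ r ^ 2 := by gcongr; exact min_le_right _ _
    -- Halving makes the level strictly smaller than `r²`, as the decay estimate demands.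
    obtain ⟨δ, hδ, hδB⟩ := hsmall (ρ ^ 2 / 2) (by positivity)
    refine ⟨δ, hδ, fun T x _ hx hx0 t ht => ?_⟩
    have h1 := hstay (ρ ^ 2 / 2) (by positivity) (by nlinarith) T x hx (hδB _ hx0) t ht
    have h2 := hexp t ht.1
    have h3 : ‖x t - xs‖ ^ 2 < ρ ^ 2 := by nlinarith [sq_nonneg ρ]
    exact (lt_of_pow_lt_pow_left₀ 2 hρpos.le h3).trans_le (min_le_left _ _)
  · obtain ⟨δ, hδ, hδB⟩ := hsmall (r ^ 2 / 2) (by positivity)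
    have hr2 : r ^ 2 / 2 < r ^ 2 := by nlinarith [pow_pos hrpos 2]
    refine ⟨δ, hδ, fun x₀ hx₀ => ⟨?_, fun x hx0 hx => ?_⟩⟩
    -- Existence: `g` is bounded, globally Lipschitz and equal to `f` on the ball, so it has a
    -- global solution. The decay estimate, applied to `g`, keeps that solution in the ball for `t ≥
    -- 0`, where it solves the equation of `f`.
    · set g : (ι → ℝ) → (ι → ℝ) := fun x => f (clamp xs r x) with hg
      have hrs : closedBall xs r ⊆ s :=
        (closedBall_subset_closedBall (min_le_right _ _)).trans hball
      have hgK : LipschitzWith K g := by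
        have h := hK.comp (lipschitzWith_clamp xs r).lipschitzOnWith (s := univ)
          fun x _ => hrs (clamp_mem_closedBall xs hrpos.le x)
        rw [mul_one] at h
        exact lipschitzOnWith_univ.mp h
      have hgL : ∀ x, ‖g x‖ ≤ (K * r.toNNReal : ℝ≥0) := by
        intro x
        have hmem := clamp_mem_closedBall xs hrpos.le x
        have h := hK.dist_le_mul _ (hrs hmem) xs (hrs (mem_closedBall_self hrpos.le))
        rw [h0, dist_zero_right] at h
        refine h.trans ?_
        rw [NNReal.coe_mul, Real.coe_toNNReal r hrpos.le]
        exact mul_le_mul_of_nonneg_left hmem K.2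
      have hgf : ∀ w, ‖w‖ < r → g (xs + w) = f (xs + w) := by
        intro w hw
        rw [hg]
        change f _ = f _
        rw [clamp_of_mem_closedBall]
        simpa using hw.le
      obtain ⟨x, hx0, hx⟩ := exists_isIntegralCurve_of_lipschitz_of_bounded hgK hgL x₀
      refine ⟨x, hx0, fun t ht => ?_⟩
      have hV := lyapunov_decay hsymm hpos hrpos hμpos
        (fun w hw => (hgf w hw).symm ▸ hf w hw) (v := r ^ 2 / 2) (by positivity) hr2
        (T := t + 1) (hx.isIntegralCurveOn _) (hδB _ (by rwa [hx0])) t ⟨ht, by linarith⟩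
      have h2 := hexp t ht
      have h3 : ‖x t - xs‖ ^ 2 < r ^ 2 := by nlinarith [hpos (x t - xs), sq_nonneg r]
      have h4 := hgf _ (lt_of_pow_lt_pow_left₀ 2 hrpos.le h3)
      rw [add_sub_cancel] at h4
      have h5 : HasDerivWithinAt x (g (x t)) (Ici 0) t := (hx t).hasDerivWithinAt
      rwa [h4] at h5
    · have hbound : ∀ t, 0 ≤ t → ‖x t - xs‖ ^ 2 ≤ r ^ 2 / 2 * Real.exp (-μ * t) := fun t ht =>
        hstay (r ^ 2 / 2) (by positivity) hr2 (t + 1) x (hx.mono fun s hs => hs.1)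
          (hδB _ (by rwa [hx0])) t ⟨ht, by linarith⟩
      have hlim : Tendsto (fun t : ℝ => r ^ 2 / 2 * Real.exp (-μ * t)) atTop (nhds 0) := by
        have h1 : Tendsto (fun t : ℝ => -μ * t) atTop atBot :=
          tendsto_id.const_mul_atTop_of_neg (by linarith)
        simpa using (Real.tendsto_exp_atBot.comp h1).const_mul (r ^ 2 / 2)
      have hsq : Tendsto (fun t => ‖x t - xs‖ ^ 2) atTop (nhds 0) :=
        squeeze_zero' (Eventually.of_forall fun t => by positivity)
          ((eventually_ge_atTop 0).mono hbound) hlim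
      rw [tendsto_iff_norm_sub_tendsto_zero]
      simpa using hsq.sqrt

end PlanarRobot

/-! ### Gradients of the energies and smoothness of the inverse inertia matrix. -/

namespace PlanarRobot

open Matrix

section Gradients

theorem hasFDerivAt_comp_apply {ι : Type*} [Fintype ι] {φ : ℝ → ℝ} {φ' : ℝ} {k : ι} {q : ι → ℝ}
    (h : HasDerivAt φ φ' (q k)) :
    HasFDerivAt (fun q' : ι → ℝ => φ (q' k))
      (φ' • (ContinuousLinearMap.proj k : (ι → ℝ) →L[ℝ] ℝ)) q :=
  h.comp_hasFDerivAt q (hasFDerivAt_apply k q)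

theorem differentiable_quadratic {ι : Type*} [Fintype ι] (N : Matrix ι ι ℝ) :
    Differentiable ℝ fun p : ι → ℝ => 1 / 2 * (p ⬝ᵥ (N *ᵥ p)) := by
  simp only [dotProduct, mulVec]
  fun_prop

variable {ι : Type*} [Fintype ι] [DecidableEq ι]

theorem hasDerivAt_real_tanh (s : ℝ) :
    HasDerivAt Real.tanh (1 / Real.cosh s ^ 2) s := by
  have h := (Real.hasDerivAt_sinh s).div (Real.hasDerivAt_cosh s) (Real.cosh_pos s).ne'
  convert! h using 1
  · ext t
    exact Real.tanh_eq_sinh_div_cosh t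
  · rw [← Real.cosh_sq_sub_sinh_sq s]
    ring

/-- The saturated feedback `zᵢ ↦ αᵢ tanh(βᵢ zᵢ)`. -/
def sat (α β z : Fin 2 → ℝ) : Fin 2 → ℝ := fun i => α i * Real.tanh (β i * z i)

theorem grad_logCosh {α β : Fin 2 → ℝ} (hβ : ∀ i, 0 < β i) (z : Fin 2 → ℝ) :
    grad (logCosh α β) z = sat α β z := by
  have h1 : ∀ i : Fin 2, HasDerivAt (fun s => α i / β i * Real.log (Real.cosh (β i * s)))
      (α i * Real.tanh (β i * z i)) (z i) := by
    intro i
    have h2 : HasDerivAt (fun s : ℝ => β i * s) (β i) (z i) := by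
      simpa using (hasDerivAt_id (z i)).const_mul (β i)
    convert! ((h2.cosh).log (Real.cosh_pos _).ne').const_mul (α i / β i) using 1
    rw [Real.tanh_eq_sinh_div_cosh]
    field_simp [(hβ i).ne']
  have h3 : HasFDerivAt (logCosh α β) (∑ i : Fin 2, (α i * Real.tanh (β i * z i)) •
      (ContinuousLinearMap.proj i : (Fin 2 → ℝ) →L[ℝ] ℝ)) z := by
    refine HasFDerivAt.fun_sum fun i _ => ?_
    exact hasFDerivAt_comp_apply (h1 i)
  ext i
  rw [grad, h3.fderiv]
  fin_cases i <;> simp [sat]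

theorem hess_logCosh {α β : Fin 2 → ℝ} (hβ : ∀ i, 0 < β i) (z : Fin 2 → ℝ) :
    hess (logCosh α β) z = diagonal fun i => β i * α i / Real.cosh (β i * z i) ^ 2 := by
  ext i j
  have h1 : HasDerivAt (fun s => α j * Real.tanh (β j * s))
      (β j * α j / Real.cosh (β j * z j) ^ 2) (z j) := by
    have h2 : HasDerivAt (fun s : ℝ => β j * s) (β j) (z j) := by
      simpa using (hasDerivAt_id (z j)).const_mul (β j)
    convert! ((hasDerivAt_real_tanh (β j * z j)).comp (z j) h2).const_mul (α j) using 1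
    ring
  have h3 : HasFDerivAt (fun y => grad (logCosh α β) y j)
      ((β j * α j / Real.cosh (β j * z j) ^ 2) •
        (ContinuousLinearMap.proj j : (Fin 2 → ℝ) →L[ℝ] ℝ)) z := by
    simp only [grad_logCosh hβ, sat]
    exact hasFDerivAt_comp_apply h1
  rw [hess, of_apply, h3.fderiv, diagonal_apply]
  by_cases h : i = j
  · subst h; simp
  · simp [h, Ne.symm h]

/-- Since `z` is a translate of `x_c`, this replaces the gradient in `x_c` by `∇Φ` at `z`. -/
theorem grad_comp_add_left (f : (ι → ℝ) → ℝ) (a x : ι → ℝ) :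
    grad (fun y => f (a + y)) x = grad f (a + x) := by
  ext i
  rw [grad, grad, fderiv_comp_add_left]

theorem grad_quadratic {N : Matrix ι ι ℝ} (hN : N.IsSymm) (p : ι → ℝ) :
    grad (fun p => 1 / 2 * (p ⬝ᵥ (N *ᵥ p))) p = N *ᵥ p := by
  ext i
  have h1 := ((differentiable_quadratic N) p).lineDeriv_eq_fderiv (v := Pi.single i 1)
  rw [grad, ← h1]
  -- Along a coordinate line the form is a quadratic polynomial in `t`; symmetry of `N` merges the
  -- two cross terms.
  have h2 : ∀ t : ℝ, 1 / 2 * ((p + t • Pi.single i 1) ⬝ᵥ (N *ᵥ (p + t • Pi.single i 1))) =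
      1 / 2 * (p ⬝ᵥ (N *ᵥ p)) + t * (N *ᵥ p) i + t ^ 2 * (1 / 2 * N i i) := by
    intro t
    have h3 : p ⬝ᵥ (N *ᵥ Pi.single i 1) = (N *ᵥ p) i := by
      rw [dotProduct_mulVec, ← mulVec_transpose, hN.eq, dotProduct_single_one]
    have h4 : (N *ᵥ Pi.single i 1) i = N i i := by simp
    simp only [mulVec_add, mulVec_smul, add_dotProduct, dotProduct_add, smul_dotProduct,
      dotProduct_smul, single_one_dotProduct, h3, h4, smul_eq_mul]
    ring
  rw [lineDeriv]
  simp only [h2]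
  have h5 : HasDerivAt (fun t : ℝ => 1 / 2 * (p ⬝ᵥ (N *ᵥ p)) + t * (N *ᵥ p) i +
      t ^ 2 * (1 / 2 * N i i)) ((N *ᵥ p) i) 0 := by
    convert! (((hasDerivAt_id (0 : ℝ)).mul_const ((N *ᵥ p) i)).const_add
      (1 / 2 * (p ⬝ᵥ (N *ᵥ p)))).add (((hasDerivAt_id (0 : ℝ)).pow 2).mul_const (1 / 2 * N i i))
      using 1
    simp
  exact h5.deriv

theorem contDiff_det {f : ℝ → Matrix ι ι ℝ} (hf : ∀ i j, ContDiff ℝ ⊤ fun θ => f θ i j) :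
    ContDiff ℝ ⊤ fun θ => (f θ).det := by
  simp only [det_apply]
  refine ContDiff.sum fun σ _ => ContDiff.const_smul _ ?_
  exact contDiff_prod fun i _ => hf _ _

/-- The entries of the inverse of a smooth family of matrices are smooth. -/
theorem contDiffAt_inv_apply {f : ℝ → Matrix ι ι ℝ} (hf : ∀ i j, ContDiff ℝ ⊤ fun θ => f θ i j)
    {θ : ℝ} (hθ : (f θ).det ≠ 0) (i j : ι) : ContDiffAt ℝ ⊤ (fun θ => (f θ)⁻¹ i j) θ := by
  -- Cramer's rule: the entries are quotients of determinants.
  simp only [inv_def, Matrix.smul_apply, Ring.inverse_eq_inv', smul_eq_mul, adjugate_apply]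
  refine ((contDiff_det hf).contDiffAt.inv hθ).mul (contDiff_det fun k l => ?_).contDiffAt
  by_cases h : k = j
  · subst h
    simp only [updateRow_self]
    exact contDiff_const
  · simp only [updateRow_ne h]
    exact hf k l

end Gradients

namespace Robot

variable (r : Robot)

theorem contDiff_M_apply (i j : Q) : ContDiff ℝ ⊤ fun θ => r.M θ i j := by
  rcases i with i | i <;> rcases j with j | j <;> simp only [M, fromBlocks_apply₁₁,
    fromBlocks_apply₁₂, fromBlocks_apply₂₁, fromBlocks_apply₂₂] <;> try exact contDiff_const
  fin_cases i <;> fin_cases j <;> simp [Ml] <;> fun_prop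

theorem isSymm_M (θ : ℝ) : (r.M θ).IsSymm := by
  refine IsSymm.fromBlocks ?_ (by simp) (isSymm_diagonal _)
  ext i j
  fin_cases i <;> fin_cases j <;> simp [Ml]

theorem isSymm_inv_M (θ : ℝ) : ((r.M θ)⁻¹).IsSymm := by
  rw [IsSymm, transpose_nonsing_inv, (r.isSymm_M θ).eq]

theorem isSymm_KS : r.KS.IsSymm := by
  refine IsSymm.fromBlocks (isSymm_diagonal _) ?_ (isSymm_diagonal _)
  simp [Ks]

/-- The entrywise derivative of `M⁻¹`. -/
def dMinv (θ : ℝ) : Matrix Q Q ℝ := of fun i j => deriv (fun θ => (r.M θ)⁻¹ i j) θ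

/-- The force `-∇_q H` contains this derivative, so smoothness of the closed loop requires it. As `⊤
+ 1 ≤ ⊤`, differentiating costs no regularity. -/
theorem contDiffAt_dMinv_apply {θ : ℝ} (hθ : (r.M θ).det ≠ 0) (i j : Q) :
    ContDiffAt ℝ ⊤ (fun θ => r.dMinv θ i j) θ := by
  simp only [dMinv, of_apply, ← fderiv_apply_one_eq_deriv]
  exact ((contDiffAt_inv_apply r.contDiff_M_apply hθ i j).fderiv_right (m := ⊤) le_top).clm_apply
    contDiffAt_const

theorem hasDerivAt_kinetic {θ : ℝ} (hθ : (r.M θ).det ≠ 0) (p : Q → ℝ) :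
    HasDerivAt (fun θ => 1 / 2 * (p ⬝ᵥ ((r.M θ)⁻¹ *ᵥ p))) (1 / 2 * (p ⬝ᵥ (r.dMinv θ *ᵥ p))) θ := by
  simp only [dotProduct, mulVec]
  refine HasDerivAt.const_mul _ (HasDerivAt.fun_sum fun i _ => HasDerivAt.const_mul _
    (HasDerivAt.fun_sum fun j _ => HasDerivAt.mul_const ?_ _))
  exact ((contDiffAt_inv_apply r.contDiff_M_apply hθ i j).differentiableAt (by simp)).hasDerivAt

theorem spring_eq (q : Q → ℝ) :
    (lnk q - mot q) ⬝ᵥ (r.Ks *ᵥ (lnk q - mot q)) = q ⬝ᵥ (r.KS *ᵥ q) := by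
  simp [dotProduct, mulVec, KS, Ks, Fintype.sum_sum_type, lnk, mot, diagonal_apply]
  ring

theorem grad_H_p (q p : Q → ℝ) :
    grad (fun p' => r.H q p') p = (r.M (lnk q 1))⁻¹ *ᵥ p := by
  rw [← grad_quadratic (r.isSymm_inv_M _)]
  ext i
  simp only [grad, H, fderiv_add_const]

/-- The kinetic energy depends on `q` only through the second link angle, hence the single basis
vector. -/
theorem grad_H_q {q : Q → ℝ} (hq : (r.M (lnk q 1)).det ≠ 0) (p : Q → ℝ) :
    grad (fun q' => r.H q' p) q =
      (1 / 2 * (p ⬝ᵥ (r.dMinv (lnk q 1) *ᵥ p))) • Pi.single (Sum.inl 1) 1 + r.KS *ᵥ q := by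
  have h1 := hasFDerivAt_comp_apply (k := Sum.inl 1) (q := q) (r.hasDerivAt_kinetic hq p)
  have h2 := (differentiable_quadratic r.KS q).hasFDerivAt
  have h3 : (fun q' => r.H q' p) = fun q' => 1 / 2 * (p ⬝ᵥ ((r.M (q' (Sum.inl 1)))⁻¹ *ᵥ p)) +
      1 / 2 * (q' ⬝ᵥ (r.KS *ᵥ q')) := by
    ext q'
    rw [H, spring_eq, lnk]
  rw [← grad_quadratic r.isSymm_KS]
  ext i
  rw [grad, h3, (h1.fun_add h2).fderiv]
  simp [grad, lnk, Pi.single_apply, eq_comm]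

end Robot

end PlanarRobot

/-! ### The closed loop in explicit form and the action of `𝒜`. -/

namespace PlanarRobot

open Matrix

section Calculus

theorem HasDerivAt.const_mulVec {m n : Type*} [Fintype m] [Fintype n] (N : Matrix m n ℝ)
    {x : ℝ → n → ℝ} {x' : n → ℝ} {t : ℝ} (hx : HasDerivAt x x' t) :
    HasDerivAt (fun s => N *ᵥ x s) (N *ᵥ x') t :=
  (Matrix.mulVecLin N).toContinuousLinearMap.hasFDerivAt.comp_hasDerivAt t hx

theorem HasDerivAt.sumElim {m n : Type*} [Fintype m] [Fintype n] {x : ℝ → m → ℝ} {y : ℝ → n → ℝ}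
    {x' : m → ℝ} {y' : n → ℝ} {t : ℝ} (hx : HasDerivAt x x' t) (hy : HasDerivAt y y' t) :
    HasDerivAt (fun s => Sum.elim (x s) (y s)) (Sum.elim x' y') t := by
  rw [hasDerivAt_pi] at *
  rintro (i | i)
  · exact hx i
  · exact hy i

theorem ContDiffAt.sumElim {E m n : Type*} [NormedAddCommGroup E] [NormedSpace ℝ E] [Fintype m]
    [Fintype n] {x : E → m → ℝ} {y : E → n → ℝ} {e : E} {k : WithTop ℕ∞}
    (hx : ContDiffAt ℝ k x e) (hy : ContDiffAt ℝ k y e) :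
    ContDiffAt ℝ k (fun s => Sum.elim (x s) (y s)) e := by
  rw [contDiffAt_pi] at *
  rintro (i | i)
  · exact hx i
  · exact hy i

theorem ContDiffAt.mulVec {E m n : Type*} [NormedAddCommGroup E] [NormedSpace ℝ E] [Fintype m]
    [Fintype n] {N : E → Matrix m n ℝ} {x : E → n → ℝ} {e : E} {k : WithTop ℕ∞}
    (hN : ∀ i j, ContDiffAt ℝ k (fun s => N s i j) e) (hx : ContDiffAt ℝ k x e) :
    ContDiffAt ℝ k (fun s => N s *ᵥ x s) e := by
  rw [contDiffAt_pi] at *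
  exact fun i => ContDiffAt.sum fun j _ => (hN i j).mul (hx j)

theorem ContDiffAt.dotProduct {E n : Type*} [NormedAddCommGroup E] [NormedSpace ℝ E]
    [Fintype n] {x y : E → n → ℝ} {e : E} {k : WithTop ℕ∞}
    (hx : ContDiffAt ℝ k x e) (hy : ContDiffAt ℝ k y e) :
    ContDiffAt ℝ k (fun s => x s ⬝ᵥ y s) e := by
  rw [contDiffAt_pi] at *
  exact ContDiffAt.sum fun j _ => (hx j).mul (hy j)

/-- If `g` is continuous at `0`, then `t ↦ t • g t` has derivative `g 0` at `0`. -/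
theorem hasDerivAt_id_smul {E : Type*} [NormedAddCommGroup E] [NormedSpace ℝ E] {g : ℝ → E}
    (hg : ContinuousAt g 0) : HasDerivAt (fun t : ℝ => t • g t) (g 0) 0 := by
  rw [hasDerivAt_iff_tendsto_slope]
  refine (hg.tendsto.mono_left nhdsWithin_le_nhds).congr' ?_
  filter_upwards [self_mem_nhdsWithin] with t ht
  have ht0 : t ≠ 0 := ht
  simp [slope, smul_smul, inv_mul_cancel₀ ht0]

theorem contDiff_tanh : ContDiff ℝ ⊤ Real.tanh := by
  have : Real.tanh = fun x => Real.sinh x / Real.cosh x := by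
    ext x
    exact Real.tanh_eq_sinh_div_cosh x
  rw [this]
  exact Real.contDiff_sinh.div Real.contDiff_cosh fun x => (Real.cosh_pos x).ne'

theorem contDiff_sat (α β : Fin 2 → ℝ) : ContDiff ℝ ⊤ (sat α β) := by
  refine contDiff_pi.mpr fun i => contDiff_const.mul (contDiff_tanh.comp ?_)
  fun_prop

/-- Because `tanh' 0 = 1`, each saturation linearizes to the gain `β α`; this is the origin of `A`
and `A_σ`. -/
theorem hasDerivAt_sat_smul (α β w : Fin 2 → ℝ) :
    HasDerivAt (fun t : ℝ => sat α β (t • w)) (diagonal (fun i => β i * α i) *ᵥ w) 0 := by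
  rw [hasDerivAt_pi]
  intro i
  have h1 : HasDerivAt (fun t : ℝ => β i * (t • w) i) (β i * w i) 0 := by
    simpa using ((hasDerivAt_id (0 : ℝ)).mul_const (w i)).const_mul (β i)
  have h2 := ((hasDerivAt_real_tanh (β i * ((0 : ℝ) • w) i)).comp (0 : ℝ) h1).const_mul (α i)
  convert! h2 using 1
  simp [mulVec_diagonal]
  ring

theorem abs_sat_le {α β : Fin 2 → ℝ} (hα : ∀ i, 0 < α i) (z : Fin 2 → ℝ) (i : Fin 2) :
    |sat α β z i| ≤ α i := by
  rw [sat, abs_mul, abs_of_pos (hα i)]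
  exact mul_le_of_le_one_right (hα i).le
    (abs_le.mpr ⟨(Real.neg_one_lt_tanh _).le, (Real.tanh_lt_one _).le⟩)

end Calculus

variable {r : Robot} {c : Controller}

theorem Controller.Admissible.u_eq (hc : c.Admissible r) (q xc : Q → ℝ) (σ : Fin 2 → ℝ) :
    c.u q xc σ = -sat c.αl c.βl (lnk q - c.qs + lnk xc) - sat c.αm c.βm (mot q - c.qs + mot xc) -
      sat c.ασ c.βσ σ := by
  rw [Controller.u, Controller.Φl, Controller.Φm, Controller.Φσ, grad_logCosh hc.βl,
    grad_logCosh hc.βm, grad_logCosh hc.βσ, Controller.zl, Controller.zm]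

theorem Controller.Admissible.abs_u_le (hc : c.Admissible r) (q xc : Q → ℝ) (σ : Fin 2 → ℝ)
    (i : Fin 2) : |c.u q xc σ i| ≤ c.αl i + c.αm i + c.ασ i := by
  have h1 := abs_le.mp (abs_sat_le (β := c.βl) hc.αl (lnk q - c.qs + lnk xc) i)
  have h2 := abs_le.mp (abs_sat_le (β := c.βm) hc.αm (mot q - c.qs + mot xc) i)
  have h3 := abs_le.mp (abs_sat_le (β := c.βσ) hc.ασ σ i)
  rw [hc.u_eq, abs_le]
  simp only [Pi.sub_apply, Pi.neg_apply]
  constructor <;> linarith [h1.1, h1.2, h2.1, h2.2, h3.1, h3.2]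

/-- The closed-loop vector field with all gradients evaluated. -/
def explicitField (r : Robot) (c : Controller) (ξ : X → ℝ) : X → ℝ :=
  Sum.elim
    (Sum.elim
      (Sum.elim
        ((r.M (lnk (qOf ξ) 1))⁻¹ *ᵥ pOf ξ)
        (-((1 / 2 * (pOf ξ ⬝ᵥ (r.dMinv (lnk (qOf ξ) 1) *ᵥ pOf ξ))) • Pi.single (Sum.inl 1) 1 +
            r.KS *ᵥ qOf ξ) - r.R₂ *ᵥ ((r.M (lnk (qOf ξ) 1))⁻¹ *ᵥ pOf ξ) +
          Sum.elim (0 : Fin 2 → ℝ)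
            (-sat c.αl c.βl (lnk (qOf ξ) - c.qs + lnk (xcOf ξ)) -
              sat c.αm c.βm (mot (qOf ξ) - c.qs + mot (xcOf ξ)) - sat c.ασ c.βσ (σOf ξ))))
      (Sum.elim
        (-(c.Rcl *ᵥ sat c.αl c.βl (lnk (qOf ξ) - c.qs + lnk (xcOf ξ))))
        (-(c.Rcm *ᵥ (sat c.αm c.βm (mot (qOf ξ) - c.qs + mot (xcOf ξ)) +
          c.Kc *ᵥ mot (xcOf ξ))))))
    (diagonal (fun i => c.βσ i * c.ασ i / Real.cosh (c.βσ i * σOf ξ i) ^ 2) *ᵥ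
      (mot (qOf ξ) - c.qs) - c.Kσ *ᵥ σOf ξ)

theorem closedLoop_eq_explicitField (hc : c.Admissible r) {ξ : X → ℝ}
    (hξ : (r.M (lnk (qOf ξ) 1)).det ≠ 0) : closedLoop r c ξ = explicitField r c ξ := by
  have h1 : r.dyn (qOf ξ) (pOf ξ) (c.u (qOf ξ) (xcOf ξ) (σOf ξ)) = Sum.elim
      ((r.M (lnk (qOf ξ) 1))⁻¹ *ᵥ pOf ξ)
      (-((1 / 2 * (pOf ξ ⬝ᵥ (r.dMinv (lnk (qOf ξ) 1) *ᵥ pOf ξ))) • Pi.single (Sum.inl 1) 1 +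
          r.KS *ᵥ qOf ξ) - r.R₂ *ᵥ ((r.M (lnk (qOf ξ) 1))⁻¹ *ᵥ pOf ξ) +
        Sum.elim (0 : Fin 2 → ℝ) (c.u (qOf ξ) (xcOf ξ) (σOf ξ))) := by
    rw [Robot.dyn, r.grad_H_q hξ, r.grad_H_p, fromBlocks_mulVec, fromRows_mulVec, B,
      fromRows_mulVec]
    simp only [Sum.elim_comp_inl, Sum.elim_comp_inr, zero_mulVec, one_mulVec, neg_mulVec,
      zero_add, ← Sum.elim_add_add, add_zero, ← sub_eq_add_neg]
  have h2 : c.dynXcl (lnk (qOf ξ)) (lnk (xcOf ξ)) =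
      -(c.Rcl *ᵥ sat c.αl c.βl (lnk (qOf ξ) - c.qs + lnk (xcOf ξ))) := by
    simp only [Controller.dynXcl, Controller.zl]
    rw [grad_comp_add_left, Controller.Φl, grad_logCosh hc.βl]
  have h3 : c.dynXcm (mot (qOf ξ)) (mot (xcOf ξ)) =
      -(c.Rcm *ᵥ (sat c.αm c.βm (mot (qOf ξ) - c.qs + mot (xcOf ξ)) +
          c.Kc *ᵥ mot (xcOf ξ))) := by
    simp only [Controller.dynXcm, Controller.zm]
    rw [grad_comp_add_left, Controller.Φm, grad_logCosh hc.βm]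
  rw [closedLoop, h1, h2, h3, hc.u_eq, Controller.dynσ, Controller.Φσ, hess_logCosh hc.βσ,
    explicitField]

/-- The matrix `𝒜` acting on a vector, block by block. -/
theorem 𝒜_mulVec (v : X → ℝ) : 𝒜 r c *ᵥ v =
    Sum.elim
      (Sum.elim
        (Sum.elim
          ((r.M (c.qs 1))⁻¹ *ᵥ pOf v)
          (-(r.KS *ᵥ qOf v) - r.R₂ *ᵥ ((r.M (c.qs 1))⁻¹ *ᵥ pOf v) +
            Sum.elim (0 : Fin 2 → ℝ)
              (-(diagonal (fun i => c.βl i * c.αl i) *ᵥ (lnk (qOf v) + lnk (xcOf v))) -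
                diagonal (fun i => c.βm i * c.αm i) *ᵥ (mot (qOf v) + mot (xcOf v)) -
                diagonal (fun i => c.βσ i * c.ασ i) *ᵥ σOf v)))
        (Sum.elim
          (-(c.Rcl *ᵥ (diagonal (fun i => c.βl i * c.αl i) *ᵥ (lnk (qOf v) + lnk (xcOf v)))))
          (-(c.Rcm *ᵥ (diagonal (fun i => c.βm i * c.αm i) *ᵥ (mot (qOf v) + mot (xcOf v)) +
            c.Kc *ᵥ mot (xcOf v))))))
      (diagonal (fun i => c.βσ i * c.ασ i) *ᵥ mot (qOf v) - c.Kσ *ᵥ σOf v) := by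
  obtain ⟨vζ, vσ, rfl⟩ : ∃ a b, v = Sum.elim a b := ⟨_, _, (Sum.elim_comp_inl_inr v).symm⟩
  obtain ⟨vqp, vx, rfl⟩ : ∃ a b, vζ = Sum.elim a b := ⟨_, _, (Sum.elim_comp_inl_inr vζ).symm⟩
  obtain ⟨vq, vp, rfl⟩ : ∃ a b, vqp = Sum.elim a b := ⟨_, _, (Sum.elim_comp_inl_inr vqp).symm⟩
  obtain ⟨ql, qm, rfl⟩ : ∃ a b, vq = Sum.elim a b := ⟨_, _, (Sum.elim_comp_inl_inr vq).symm⟩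
  obtain ⟨xl, xm, rfl⟩ : ∃ a b, vx = Sum.elim a b := ⟨_, _, (Sum.elim_comp_inl_inr vx).symm⟩
  have e1 : pOf (Sum.elim (Sum.elim (Sum.elim (Sum.elim ql qm) vp) (Sum.elim xl xm)) vσ) = vp := rfl
  have e2 : qOf (Sum.elim (Sum.elim (Sum.elim (Sum.elim ql qm) vp) (Sum.elim xl xm)) vσ) =
    Sum.elim ql qm := rfl
  have e3 : xcOf (Sum.elim (Sum.elim (Sum.elim (Sum.elim ql qm) vp) (Sum.elim xl xm)) vσ) =
    Sum.elim xl xm := rfl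
  have e4 : σOf (Sum.elim (Sum.elim (Sum.elim (Sum.elim ql qm) vp) (Sum.elim xl xm)) vσ) = vσ := rfl
  have e5 : ∀ a b : Fin 2 → ℝ, lnk (Sum.elim a b) = a := fun _ _ => rfl
  have e6 : ∀ a b : Fin 2 → ℝ, mot (Sum.elim a b) = b := fun _ _ => rfl
  rw [e1, e2, e3, e4, e5, e5, e6, e6]
  have hA : ∀ a b : Fin 2 → ℝ, c.A *ᵥ Sum.elim a b =
      Sum.elim (diagonal (fun i => c.βl i * c.αl i) *ᵥ a)
        (diagonal (fun i => c.βm i * c.αm i) *ᵥ b) := fun a b => by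
    simp only [Controller.A, fromBlocks_mulVec, Sum.elim_comp_inl, Sum.elim_comp_inr, zero_mulVec,
      add_zero, zero_add]
  have hKC : ∀ a b : Fin 2 → ℝ, c.KC *ᵥ Sum.elim a b = Sum.elim (0 : Fin 2 → ℝ) (c.Kc *ᵥ b) := fun a b => by
    simp only [Controller.KC, fromBlocks_mulVec, Sum.elim_comp_inl, Sum.elim_comp_inr, zero_mulVec,
      add_zero, zero_add]
  have hH : hessHζ r c *ᵥ Sum.elim (Sum.elim (Sum.elim ql qm) vp) (Sum.elim xl xm) =
      Sum.elim (Sum.elim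
        (r.KS *ᵥ Sum.elim ql qm + Sum.elim
          (diagonal (fun i => c.βl i * c.αl i) *ᵥ (ql + xl))
          (diagonal (fun i => c.βm i * c.αm i) *ᵥ (qm + xm)))
        ((r.M (c.qs 1))⁻¹ *ᵥ vp))
        (Sum.elim (diagonal (fun i => c.βl i * c.αl i) *ᵥ (ql + xl))
          (diagonal (fun i => c.βm i * c.αm i) *ᵥ (qm + xm) + c.Kc *ᵥ xm)) := by
    simp only [hessHζ, fromBlocks_mulVec, fromRows_mulVec, fromCols_mulVec, Sum.elim_comp_inl,
      Sum.elim_comp_inr, zero_mulVec, add_zero, zero_add, add_mulVec, hA, hKC, ← Sum.elim_add_add,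
      mulVec_add, add_assoc]
  rw [𝒜, fromBlocks_mulVec, Sum.elim_comp_inl, Sum.elim_comp_inr, ← mulVec_mulVec, hH]
  -- In the `p` rows, `Γ` cancels the link term `β_l α_l (q_l + x_{c_l})` of `-∇_q H_ζ` and moves it
  -- to the motor rows, where the input acts.
  simp only [Fζ, Controller.Aξ₁, Controller.Aξ₂, Controller.Aσ, transpose_fromRows,
    fromBlocks_mulVec, fromRows_mulVec, fromCols_mulVec, Sum.elim_comp_inl,
    Sum.elim_comp_inr, zero_mulVec, one_mulVec, neg_mulVec, add_zero, zero_add, transpose_zero,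
    diagonal_transpose, ← Sum.elim_add_add, sub_eq_add_neg, mulVec_add, neg_add]
  ext (((( i | i) | (i | i)) | (i | i)) | i)
  all_goals simp only [Sum.elim_inl, Sum.elim_inr, Pi.add_apply, Pi.neg_apply, Pi.zero_apply]
  all_goals ring

end PlanarRobot

/-! ### Linearization at the equilibrium and conclusion. -/

namespace PlanarRobot

open Matrix

theorem IsHurwitz.isUnit {ι : Type*} [Fintype ι] [DecidableEq ι] {A : Matrix ι ι ℝ}
    (hA : IsHurwitz A) : IsUnit A := by
  have h1 : IsUnit ((algebraMap ℝ ℂ).mapMatrix A) := by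
    have : (0 : ℂ) ∉ spectrum ℂ ((algebraMap ℝ ℂ).mapMatrix A) := fun h => by
      have := hA 0 h
      norm_num at this
    simpa [spectrum.notMem_iff] using this
  rw [isUnit_iff_isUnit_det, ← RingHom.map_det] at h1
  rw [isUnit_iff_isUnit_det]
  exact (isUnit_map_iff (algebraMap ℝ ℂ) _).mp h1

variable {r : Robot} {c : Controller}

/-- If `𝒜` is Hurwitz, the inertia matrix is invertible at the reference. -/
theorem det_M_ne_zero_of_isHurwitz (hA : IsHurwitz (𝒜 r c)) : (r.M (c.qs 1)).det ≠ 0 := by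
  intro h
  -- Positive constants do not ensure invertibility, as `det M_l = a₁ a₂ - b² cos² θ`. But if `M_*`
  -- were singular, its `⁻¹` would be `0` by convention, the `q` rows of `𝒜` would vanish, and `𝒜`
  -- would not be surjective.
  obtain ⟨v, hv⟩ := (mulVec_surjective_iff_isUnit.mpr hA.isUnit)
    (Pi.single (Sum.inl (Sum.inl (Sum.inl (Sum.inl 0)))) 1)
  have h1 := congrFun hv (Sum.inl (Sum.inl (Sum.inl (Sum.inl 0))))
  rw [𝒜_mulVec, nonsing_inv_apply_not_isUnit _ (by simp [h])] at h1
  simp at h1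

theorem qOf_ξs_add (v : X → ℝ) (t : ℝ) :
    qOf (ξs c + t • v) = Sum.elim c.qs c.qs + t • qOf v := rfl

theorem pOf_ξs_add (v : X → ℝ) (t : ℝ) : pOf (ξs c + t • v) = t • pOf v := by
  ext i; simp [pOf, ξs]

theorem xcOf_ξs_add (v : X → ℝ) (t : ℝ) : xcOf (ξs c + t • v) = t • xcOf v := by
  ext i; simp [xcOf, ξs]

theorem σOf_ξs_add (v : X → ℝ) (t : ℝ) : σOf (ξs c + t • v) = t • σOf v := by
  ext i; simp [σOf, ξs]

theorem lnk_add_smul (a b : Fin 2 → ℝ) (q : Q → ℝ) (t : ℝ) :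
    lnk (Sum.elim a b + t • q) = a + t • lnk q := rfl

theorem mot_add_smul (a b : Fin 2 → ℝ) (q : Q → ℝ) (t : ℝ) :
    mot (Sum.elim a b + t • q) = b + t • mot q := rfl

theorem lnk_smul (q : Q → ℝ) (t : ℝ) : lnk (t • q) = t • lnk q := rfl

theorem mot_smul (q : Q → ℝ) (t : ℝ) : mot (t • q) = t • mot q := rfl

/-- The springs are relaxed when links and motors agree. -/
theorem KS_mulVec_diag (a : Fin 2 → ℝ) : r.KS *ᵥ Sum.elim a a = 0 := by
  rw [Robot.KS, fromBlocks_mulVec]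
  simp only [Sum.elim_comp_inl, Sum.elim_comp_inr, neg_mulVec, add_neg_cancel, neg_add_cancel]
  exact Sum.elim_zero_zero

theorem contDiffAt_explicitField {ξ : X → ℝ} (hξ : (r.M (lnk (qOf ξ) 1)).det ≠ 0) :
    ContDiffAt ℝ ⊤ (explicitField r c) ξ := by
  have hq : ContDiffAt ℝ ⊤ qOf ξ := by unfold qOf; fun_prop
  have hp : ContDiffAt ℝ ⊤ pOf ξ := by unfold pOf; fun_prop
  have hθ : ContDiffAt ℝ ⊤ (fun ξ => lnk (qOf ξ) 1) ξ := by unfold lnk qOf; fun_prop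
  have hql : ContDiffAt ℝ ⊤ (fun ξ => lnk (qOf ξ)) ξ := by unfold lnk qOf; fun_prop
  have hqm : ContDiffAt ℝ ⊤ (fun ξ => mot (qOf ξ)) ξ := by unfold mot qOf; fun_prop
  have hxl : ContDiffAt ℝ ⊤ (fun ξ => lnk (xcOf ξ)) ξ := by unfold lnk xcOf; fun_prop
  have hxm : ContDiffAt ℝ ⊤ (fun ξ => mot (xcOf ξ)) ξ := by unfold mot xcOf; fun_prop
  have hσ : ContDiffAt ℝ ⊤ σOf ξ := by unfold σOf; fun_prop
  have hconst : ∀ {m n : Type} [Fintype m] [Fintype n] (N : Matrix m n ℝ) {x : (X → ℝ) → n → ℝ},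
      ContDiffAt ℝ ⊤ x ξ → ContDiffAt ℝ ⊤ (fun ξ => N *ᵥ x ξ) ξ :=
    fun N x hx => ContDiffAt.mulVec (N := fun _ => N) (fun _ _ => contDiffAt_const) hx
  have hN := ContDiffAt.mulVec (N := fun ξ => (r.M (lnk (qOf ξ) 1))⁻¹)
    (fun i j => (contDiffAt_inv_apply r.contDiff_M_apply hξ i j).comp ξ hθ) hp
  have hdN := ContDiffAt.mulVec (N := fun ξ => r.dMinv (lnk (qOf ξ) 1))
    (fun i j => (r.contDiffAt_dMinv_apply hξ i j).comp ξ hθ) hp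
  have hl : ContDiffAt ℝ ⊤ (fun ξ => sat c.αl c.βl (lnk (qOf ξ) - c.qs + lnk (xcOf ξ))) ξ :=
    (contDiff_sat _ _).contDiffAt.comp ξ ((hql.sub contDiffAt_const).add hxl)
  have hm : ContDiffAt ℝ ⊤ (fun ξ => sat c.αm c.βm (mot (qOf ξ) - c.qs + mot (xcOf ξ))) ξ :=
    (contDiff_sat _ _).contDiffAt.comp ξ ((hqm.sub contDiffAt_const).add hxm)
  have hs : ContDiffAt ℝ ⊤ (fun ξ => sat c.ασ c.βσ (σOf ξ)) ξ :=
    (contDiff_sat _ _).contDiffAt.comp ξ hσ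
  have hD : ∀ i j, ContDiffAt ℝ ⊤ (fun ξ => diagonal
      (fun i => c.βσ i * c.ασ i / Real.cosh (c.βσ i * σOf ξ i) ^ 2) i j) ξ := by
    intro i j
    by_cases h : i = j
    · subst h
      simp only [diagonal_apply_eq]
      refine contDiffAt_const.div ?_ (pow_pos (Real.cosh_pos _) 2).ne'
      exact ((contDiffAt_const.mul (contDiffAt_pi.mp hσ i)).cosh).pow 2
    · simp only [diagonal_apply_ne _ h]
      exact contDiffAt_const
  refine ContDiffAt.sumElim (ContDiffAt.sumElim (ContDiffAt.sumElim hN ?_)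
    (ContDiffAt.sumElim (hconst _ hl).neg (hconst _ (hm.add (hconst _ hxm))).neg))
    ((ContDiffAt.mulVec hD (hqm.sub contDiffAt_const)).sub (hconst _ hσ))
  have hkin := (contDiffAt_const (c := (1 / 2 : ℝ))).mul (ContDiffAt.dotProduct hp hdN)
  exact (((hkin.smul contDiffAt_const).add (hconst r.KS hq)).neg.sub (hconst r.R₂ hN)).add
    (ContDiffAt.sumElim contDiffAt_const ((hl.neg.sub hm).sub hs))

/-- The derivative of the closed loop at `ξ_*` in a direction `v` is `𝒜 v`. -/
theorem hasDerivAt_explicitField_line (h : (r.M (c.qs 1)).det ≠ 0) (v : X → ℝ) :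
    HasDerivAt (fun t : ℝ => explicitField r c (ξs c + t • v)) (𝒜 r c *ᵥ v) 0 := by
  have hθ : Continuous fun t : ℝ => c.qs 1 + t * lnk (qOf v) 1 := by fun_prop
  have hNc : ∀ i j, ContinuousAt
      (fun t : ℝ => (r.M (c.qs 1 + t * lnk (qOf v) 1))⁻¹ i j) 0 := fun i j =>
    ContinuousAt.comp (f := fun t : ℝ => c.qs 1 + t * lnk (qOf v) 1)
      (g := fun θ => (r.M θ)⁻¹ i j)
      (contDiffAt_inv_apply r.contDiff_M_apply (by simpa using h) i j).continuousAt hθ.continuousAt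
  have hdNc : ∀ i j, ContinuousAt
      (fun t : ℝ => r.dMinv (c.qs 1 + t * lnk (qOf v) 1) i j) 0 := fun i j =>
    ContinuousAt.comp (f := fun t : ℝ => c.qs 1 + t * lnk (qOf v) 1)
      (g := fun θ => r.dMinv θ i j)
      (r.contDiffAt_dMinv_apply (by simpa using h) i j).continuousAt hθ.continuousAt
  have hmulVec : ∀ {n : Type} [Fintype n] {N : ℝ → Matrix n n ℝ} (w : n → ℝ),
      (∀ i j, ContinuousAt (fun t => N t i j) 0) → ContinuousAt (fun t => N t *ᵥ w) 0 :=
    fun w hN => continuousAt_pi.mpr fun i =>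
      tendsto_finsetSum _ fun j _ => (hN i j).mul continuousAt_const
  -- On the line `ξ_* + t v` the momentum is `t p`, so mere continuity of `M⁻¹` gives the derivative
  -- at `0`. The kinetic force carries `t²` and drops out; the Hessian of `Φ_σ` multiplies `t q_m`
  -- and contributes its value at `0`.
  have hNp : HasDerivAt (fun t : ℝ => t • ((r.M (c.qs 1 + t * lnk (qOf v) 1))⁻¹ *ᵥ pOf v))
      ((r.M (c.qs 1))⁻¹ *ᵥ pOf v) 0 := by
    simpa using hasDerivAt_id_smul (hmulVec (pOf v) hNc)
  have hkin : HasDerivAt (fun t : ℝ => t • t • (1 / 2 *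
      (pOf v ⬝ᵥ (r.dMinv (c.qs 1 + t * lnk (qOf v) 1) *ᵥ pOf v)))) 0 0 := by
    have h1 : ContinuousAt (fun t : ℝ =>
        pOf v ⬝ᵥ (r.dMinv (c.qs 1 + t * lnk (qOf v) 1) *ᵥ pOf v)) 0 :=
      tendsto_finsetSum _ fun j _ =>
        continuousAt_const.mul (continuousAt_pi.mp (hmulVec (pOf v) hdNc) j)
    simpa using hasDerivAt_id_smul (continuousAt_id.smul (continuousAt_const.mul h1))
  have hid : ∀ {n : Type} [Fintype n] (w : n → ℝ), HasDerivAt (fun t : ℝ => t • w) w 0 :=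
    fun w => by simpa using (hasDerivAt_id (0 : ℝ)).smul_const w
  have hl := hasDerivAt_sat_smul c.αl c.βl (lnk (qOf v) + lnk (xcOf v))
  have hm := hasDerivAt_sat_smul c.αm c.βm (mot (qOf v) + mot (xcOf v))
  have hs := hasDerivAt_sat_smul c.ασ c.βσ (σOf v)
  have hD : HasDerivAt (fun t : ℝ => t •
      (diagonal (fun i => c.βσ i * c.ασ i / Real.cosh (c.βσ i * (t • σOf v) i) ^ 2) *ᵥ mot (qOf v)))
      (diagonal (fun i => c.βσ i * c.ασ i) *ᵥ mot (qOf v)) 0 := by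
    have h1 : ContinuousAt (fun t : ℝ => diagonal
        (fun i => c.βσ i * c.ασ i / Real.cosh (c.βσ i * (t • σOf v) i) ^ 2) *ᵥ mot (qOf v)) 0 := by
      refine hmulVec _ fun i j => ?_
      by_cases hij : i = j
      · subst hij
        simp only [diagonal_apply_eq]
        refine continuousAt_const.div ?_ (pow_pos (Real.cosh_pos _) 2).ne'
        exact (Real.continuous_cosh.comp (by simp only [Pi.smul_apply]; fun_prop)).continuousAt.pow 2
      · simp only [diagonal_apply_ne _ hij]
        exact continuousAt_const
    simpa using hasDerivAt_id_smul h1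
  have key := HasDerivAt.sumElim (HasDerivAt.sumElim (HasDerivAt.sumElim hNp
    (((((hkin.smul_const (Pi.single (Sum.inl 1) 1 : Q → ℝ)).add
      (HasDerivAt.const_mulVec r.KS (hid (qOf v)))).neg.sub
        (HasDerivAt.const_mulVec r.R₂ hNp)).add
      (HasDerivAt.sumElim (hasDerivAt_const (0 : ℝ) (0 : Fin 2 → ℝ)) ((hl.neg.sub hm).sub hs)))))
    (HasDerivAt.sumElim (HasDerivAt.const_mulVec c.Rcl hl).neg
      (HasDerivAt.const_mulVec c.Rcm
        (hm.add (HasDerivAt.const_mulVec c.Kc (hid (mot (xcOf v)))))).neg))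
    (hD.sub (HasDerivAt.const_mulVec c.Kσ (hid (σOf v))))
  convert! key using 1
  · ext1 t
    have hθt : lnk (qOf (ξs c + t • v)) 1 = c.qs 1 + t * lnk (qOf v) 1 := rfl
    simp only [explicitField, hθt]
    simp only [qOf_ξs_add, pOf_ξs_add, xcOf_ξs_add, σOf_ξs_add, lnk_add_smul, mot_add_smul,
      lnk_smul, mot_smul, add_sub_cancel_left, ← smul_add, mulVec_add, KS_mulVec_diag, zero_add,
      mulVec_smul, smul_dotProduct, dotProduct_smul, smul_eq_mul, Pi.add_apply, Pi.sub_apply,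
      Pi.neg_apply, mul_left_comm (1 / 2 : ℝ) t]
  · rw [𝒜_mulVec]
    simp only [zero_smul, zero_add]

theorem explicitField_ξs : explicitField r c (ξs c) = 0 := by
  have hq : qOf (ξs c) = Sum.elim c.qs c.qs := rfl
  have hp : pOf (ξs c) = 0 := rfl
  have hx : xcOf (ξs c) = 0 := rfl
  have hσ : σOf (ξs c) = 0 := rfl
  have hl : lnk (Sum.elim c.qs c.qs) = c.qs := rfl
  have hm : mot (Sum.elim c.qs c.qs) = c.qs := rfl
  have hl0 : lnk 0 = 0 := rfl
  have hm0 : mot 0 = 0 := rfl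
  have hs : ∀ α β : Fin 2 → ℝ, sat α β 0 = 0 := fun α β => by ext i; simp [sat]
  rw [explicitField, hq, hp, hx, hσ, hl, hm, hl0, hm0]
  simp only [sub_self, add_zero, hs, mulVec_zero, KS_mulVec_diag, zero_dotProduct, mul_zero,
    zero_smul, neg_zero, Sum.elim_zero_zero]

theorem isLocallyAsymptoticallyStable_closedLoop (hc : c.Admissible r)
    (hA : IsHurwitz (𝒜 r c)) : IsLocallyAsymptoticallyStable (closedLoop r c) (ξs c) := by
  have hdet := det_M_ne_zero_of_isHurwitz hA
  have hdet' : (r.M (lnk (qOf (ξs c)) 1)).det ≠ 0 := hdet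
  have hcont : Continuous fun ξ => (r.M (lnk (qOf ξ) 1)).det :=
    (contDiff_det r.contDiff_M_apply).continuous.comp (by unfold lnk qOf; fun_prop)
  have heq : closedLoop r c =ᶠ[nhds (ξs c)] explicitField r c := by
    filter_upwards [hcont.continuousAt.eventually_ne hdet'] with ξ hξ
    exact closedLoop_eq_explicitField hc hξ
  have hsmooth : ContDiffAt ℝ ⊤ (closedLoop r c) (ξs c) :=
    (contDiffAt_explicitField hdet').congr_of_eventuallyEq heq
  have hstrict := hsmooth.hasStrictFDerivAt (by simp)
  obtain ⟨K, s, hs, hK⟩ := hstrict.exists_lipschitzOnWith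
  refine isLocallyAsymptoticallyStable_of_isHurwitz (heq.self_of_nhds.trans explicitField_ξs) ?_
    ⟨K, s, hs, hK⟩ hA
  -- The Fréchet derivative is already known to exist, so it is determined by its values on
  -- directions `v`.
  convert! hstrict.hasFDerivAt using 1
  ext1 v
  have h1 : HasFDerivAt (explicitField r c) (fderiv ℝ (closedLoop r c) (ξs c)) (ξs c) :=
    hstrict.hasFDerivAt.congr_of_eventuallyEq heq.symm
  exact (hasDerivAt_explicitField_line hdet v).unique (h1.hasLineDerivAt v)

end PlanarRobot

end

theorem proposition3 (r : PlanarRobot.Robot) (c : PlanarRobot.Controller)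
    (hr : r.Positive) (hc : c.Admissible r) :
    (∀ (q xc : PlanarRobot.Q → ℝ) (σ : Fin 2 → ℝ) (i : Fin 2),
      -(c.αl i + c.αm i + c.ασ i) ≤ c.u q xc σ i ∧
        c.u q xc σ i ≤ c.αl i + c.αm i + c.ασ i) ∧
    (PlanarRobot.IsHurwitz (PlanarRobot.𝒜 r c) →
      PlanarRobot.IsLocallyAsymptoticallyStable
        (PlanarRobot.closedLoop r c) (PlanarRobot.ξs c)) :=
  ⟨fun q xc σ i => abs_le.mp (hc.abs_u_le q xc σ i),
    PlanarRobot.isLocallyAsymptoticallyStable_closedLoop hc⟩
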